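/- Fix $r,\sigma\in[1,\infty)$ and $d\in\mathbb N$. For a Borel probability measure $\mathbb Q$ on $\mathbb R^{d+1}$ write $(\mathbf X,Y)\sim\mathbb Q$ with $\mathbf X\in\mathbb R^d$ and $Y\in\mathbb R$. **Penalty.** Let $\rho:\mathbb R^d\to[0,\infty)$ be convex with conjugate $\rho^*(\mathbf b)=\sup_{\mathbf x}(\mathbf b^\top\mathbf x-\rho(\mathbf x))$. For $\boldsymbol\beta\in\mathbb R^d$ and a subgradient $\boldsymbol\beta^*\in\partial\rho(\boldsymbol\beta)$ put $\mathbf v(\boldsymbol\beta,\boldsymbol\beta^*)=\boldsymbol\beta^*-\frac{\boldsymbol\beta}{\boldsymbol\beta^\top\boldsymbol\beta}\rho^*(\boldsymbol\beta^*)$, where the second term is $0$ if $\boldsymbol\beta=0$. Call $\boldsymbol\beta^*\in\partial\rho(\boldsymbol\beta)$ admissible if $|\boldsymbol\gamma^\top\mathbf v(\boldsymbol\beta,\boldsymbol\beta^*)|\le\rho(\boldsymbol\gamma)$ for all $\boldsymbol\gamma\in\mathbb R^d$, and suppose that every $\boldsymbol\beta\in\mathbb R^d$ has an admissible subgradient.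 Suppose also that $c_d\|(\boldsymbol\gamma,-1)\|\le\rho(\boldsymbol\gamma)+1$ for all $\boldsymbol\gamma\in\mathbb R^d$, for some norm $\|\cdot\|$ on $\mathbb R^{d+1}$ with dual norm $\|\mathbf z\|_*=\sup_{\|\mathbf x\|=1}\mathbf x^\top\mathbf z$ and some $c_d>0$, and put $c_{\rho,d}=\max\{1/c_d,1\}$. **Metric and balls.** With $\Pi(\mathbb P,\mathbb Q)$ the set of couplings of $\mathbb P$ and $\mathbb Q$, let $$\widehat{\mathcal W}_{r,\rho,\sigma}(\mathbb P,\mathbb Q)=\sup_{\boldsymbol\gamma\in\mathbb R^d}\ \inf_{\pi\in\Pi(\mathbb P,\mathbb Q)}\frac{1}{\sigma+\rho(\boldsymbol\gamma)}\,\mathbb E_\pi\big[|(Y-\mathbf X^\top\boldsymbol\gamma)-(\widetilde Y-\widetilde{\mathbf X}^\top\boldsymbol\gamma)|^r\big]^{1/r},$$ and let $B_\delta(\mathbb P)$ be the set of all Borel probability measures $\mathbb Q$ on $\mathbb R^{d+1}$ with finite $r$-th moment and $\widehat{\mathcal W}_{r,\rho,\sigma}(\mathbb Q,\mathbb P)\le\delta$.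 **Data.** Let $\mathbb P$ be a Borel probability measure on $\mathbb R^{d+1}$ with compact support, let $n\ge1$, let $\mathbb P_n$ be the empirical measure of $n$ i.i.d. draws from $\mathbb P$, let $\alpha\in(0,1)$, and put $$C=\Big(180\sqrt{d+2}+\sqrt{2\log(1/\alpha)}\Big)\,\mathrm{diam}(\mathrm{supp}\,\mathbb P)^r,$$ where the diameter is measured in $\|\cdot\|_*$. **Uncertainty set and null hypothesis.** Let $\delta\ge0$ and $B\subseteq B_\delta(\mathbb P)$. For $\boldsymbol\beta\in\mathbb R^d$ and an admissible $\boldsymbol\beta^*\in\partial\rho(\boldsymbol\beta)$ let $\mathbb P^*_{\boldsymbol\beta}$ be the law of $(\mathbf X-e\,\mathbf v(\boldsymbol\beta,\boldsymbol\beta^*),\,Y+\sigma e)$ with $(\mathbf X,Y)\sim\mathbb P$ and $e=\delta\,(Y-\mathbf X^\top\boldsymbol\beta)\,/\,\mathbb E_{\mathbb P}[|Y-\mathbf X^\top\boldsymbol\beta|^r]^{1/r}$, where $e=\delta$ if the denominator vanishes. Let $\boldsymbol\beta_1,\boldsymbol\beta_2$ be two estimators, possibly depending on the data, such that almost surely,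 for $j=1,2$, the supremum over $\mathbb Q\in B$ of $\mathbb E_{\mathbb Q}[|Y-\mathbf X^\top\boldsymbol\beta_j|^r]^{1/r}$ is achieved at $\mathbb P^*_{\boldsymbol\beta_j}\in B$ for some admissible subgradient at $\boldsymbol\beta_j$, and $$\sup_{\mathbb Q\in B}\mathbb E_{\mathbb Q}\big[|Y-\mathbf X^\top\boldsymbol\beta_1|^r\big]^{1/r}\le\sup_{\mathbb Q\in B}\mathbb E_{\mathbb Q}\big[|Y-\mathbf X^\top\boldsymbol\beta_2|^r\big]^{1/r}.$$ **Conclusion.** The statistic $$T_n=n^{1/(2r)}\,\frac{\mathbb E_{\mathbb P_n}[|Y-\mathbf X^\top\boldsymbol\beta_1|^r]^{1/r}-\mathbb E_{\mathbb P_n}[|Y-\mathbf X^\top\boldsymbol\beta_2|^r]^{1/r}+\delta\rho(\boldsymbol\beta_1)-\delta\rho(\boldsymbol\beta_2)}{2\sigma+\rho(\boldsymbol\beta_1)+\rho(\boldsymbol\beta_2)}$$ satisfies $P\big(T_n>c_{\rho,d}\,C^{1/r}\big)\le\alpha$. -/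

import Mathlib

open MeasureTheory ProbabilityTheory
open scoped ENNReal

noncomputable section

namespace RhoMSW

/-- The space `ℝ^d` of covariates and of linear predictors. -/
abbrev Cov (d : ℕ) : Type := EuclideanSpace ℝ (Fin d)

/-- The space `ℝ^(d+1)` of pairs `(x, y)` of covariates and outcome. -/
abbrev Obs (d : ℕ) : Type := EuclideanSpace ℝ (Fin d) × ℝ

variable {d : ℕ}

/-! ### Convex penalties -/

/-- `b` is a subgradient of `ρ` at `β`. -/
def IsSubgradient (ρ : Cov d → ℝ) (β b : Cov d) : Prop :=
  ∀ x : Cov d, ρ β + inner ℝ b (x - β) ≤ ρ x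

/-- The convex conjugate `ρ^*(b) = sup_x (bᵀ x - ρ x)`. It is only evaluated at subgradients of `ρ`,
where the supremum is finite. -/
def conjugate (ρ : Cov d → ℝ) (b : Cov d) : ℝ :=
  ⨆ x : Cov d, (inner ℝ b x - ρ x)

/-- The vector `β^* - (β / βᵀβ) ρ^*(β^*)`, where `b = β^*`. For `β = 0` the second term is `0`. -/
def loading (ρ : Cov d → ℝ) (β b : Cov d) : Cov d :=
  b - (conjugate ρ b / inner ℝ β β) • β

/-- `b` is a subgradient of `ρ` at `β` with `|γᵀ (β^* - (β / βᵀβ) ρ^*(β^*))| ≤ ρ γ` for all `γ`. -/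
def IsGoodSubgradient (ρ : Cov d → ℝ) (β b : Cov d) : Prop :=
  IsSubgradient ρ β b ∧ ∀ γ : Cov d, |inner ℝ γ (loading ρ β b)| ≤ ρ γ

/-! ### Prediction errors, couplings, the `ρ`-max-sliced Wasserstein metric and its balls -/

/-- The residual `y - xᵀ β`. -/
def predResid (β : Cov d) (z : Obs d) : ℝ := z.2 - inner ℝ z.1 β

/-- The prediction error `E_Q[|Y - Xᵀ β|^r]^(1/r)`, with values in `[0, ∞]`. -/
def predError (r : ℝ) (Q : Measure (Obs d)) (β : Cov d) : ℝ≥0∞ :=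
  (∫⁻ z, ENNReal.ofReal (|predResid β z| ^ r) ∂Q) ^ (1 / r)

/-- The couplings of `P` and `Q`. -/
def couplings (P Q : Measure (Obs d)) : Set (Measure (Obs d × Obs d)) :=
  {π | π.map Prod.fst = P ∧ π.map Prod.snd = Q}

/-- The `ρ`-max-sliced Wasserstein metric, with values in `[0, ∞]`. -/
def rhoMSW (r : ℝ) (ρ : Cov d → ℝ) (σ : ℝ) (P Q : Measure (Obs d)) : ℝ≥0∞ :=
  ⨆ γ : Cov d, ⨅ π ∈ couplings P Q,
    (∫⁻ w, ENNReal.ofReal (|predResid γ w.1 - predResid γ w.2| ^ r) ∂π) ^ (1 / r)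
      / ENNReal.ofReal (σ + ρ γ)

/-- Borel probability measures on `ℝ^(d+1)` with finite `r`-th moment. -/
def ProbMoment (d : ℕ) (r : ℝ) : Set (Measure (Obs d)) :=
  {Q | IsProbabilityMeasure Q ∧ ∫⁻ z, ENNReal.ofReal (‖z‖ ^ r) ∂Q < ∞}

/-- The ball of radius `δ` around `P` in the `ρ`-max-sliced Wasserstein metric. -/
def mswBall (r : ℝ) (ρ : Cov d → ℝ) (σ δ : ℝ) (P : Measure (Obs d)) : Set (Measure (Obs d)) :=
  {Q | Q ∈ ProbMoment d r ∧ rhoMSW r ρ σ Q P ≤ ENNReal.ofReal δ}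

/-! ### Worst-case distributions -/

open Classical in
/-- The error `e = δ (y - xᵀβ) / E_P[|Y - Xᵀβ|^r]^(1/r)`. If the denominator vanishes (that is, if
`Y = Xᵀβ` holds `P`-almost surely), then the quotient is read as `1`, so that `e = δ`. -/
def shift (r δ : ℝ) (P : Measure (Obs d)) (β : Cov d) (z : Obs d) : ℝ :=
  if predError r P β = 0 then δ else δ * predResid β z / (predError r P β).toReal

/-- The law of `(X - e (β^* - (β / βᵀβ) ρ^*(β^*)), Y + σ e)` for `(X, Y) ∼ P`, where `b = β^*`. -/
def worstCase (r : ℝ) (ρ : Cov d → ℝ) (σ δ : ℝ) (P : Measure (Obs d)) (β b : Cov d) :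
    Measure (Obs d) :=
  P.map fun z => (z.1 - shift r δ P β z • loading ρ β b, z.2 + σ * shift r δ P β z)

/-- The supremum over `B` of the prediction error of `β` is achieved at the worst-case distribution
`P^*_β` (formed with some subgradient as in `IsGoodSubgradient`). -/
def SupAchieved (r : ℝ) (ρ : Cov d → ℝ) (σ δ : ℝ) (P : Measure (Obs d))
    (B : Set (Measure (Obs d))) (β : Cov d) : Prop :=
  ∃ b : Cov d, IsGoodSubgradient ρ β b ∧ worstCase r ρ σ δ P β b ∈ B ∧
    ∀ Q ∈ B, predError r Q β ≤ predError r (worstCase r ρ σ δ P β b) β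

/-- The null hypothesis: the worst-case error of `β₁` over `B` is at most that of `β₂`. -/
def NullHypothesis (r : ℝ) (B : Set (Measure (Obs d))) (β₁ β₂ : Cov d) : Prop :=
  (⨆ Q ∈ B, predError r Q β₁) ≤ ⨆ Q ∈ B, predError r Q β₂

/-! ### Dual norm, diameter of the support, and the constants -/

/-- The dual norm `‖z‖_* = sup {⟨x, z⟩ : ‖x‖ = 1}` of a norm on `ℝ^(d+1)`. -/
def dualNorm (N : Seminorm ℝ (Obs d)) (z : Obs d) : ℝ :=
  sSup {t | ∃ x : Obs d, N x = 1 ∧ t = inner ℝ x.1 z.1 + x.2 * z.2}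

/-- The diameter of the support of `P` in the dual norm. -/
def suppDiam (N : Seminorm ℝ (Obs d)) (P : Measure (Obs d)) : ℝ :=
  sSup {t | ∃ z ∈ P.support, ∃ z' ∈ P.support, t = dualNorm N (z - z')}

/-- `C = (180 √(d+2) + √(2 log(1/α))) diam(supp P)^r`. -/
def constC (r α : ℝ) (N : Seminorm ℝ (Obs d)) (P : Measure (Obs d)) : ℝ :=
  (180 * √((d : ℝ) + 2) + √(2 * Real.log (1 / α))) * suppDiam N P ^ r

/-! ### The test statistic -/

/-- The empirical measure of the sample `z₁, …, zₙ`. -/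
def empirical {n : ℕ} (z : Fin n → Obs d) : Measure (Obs d) :=
  (n : ℝ≥0∞)⁻¹ • ∑ i, Measure.dirac (z i)

/-- The statistic `T_n` computed from the sample `z₁, …, zₙ` and the linear predictors `β₁, β₂`. -/
def testStat (r : ℝ) (ρ : Cov d → ℝ) (σ δ : ℝ) {n : ℕ} (z : Fin n → Obs d) (β₁ β₂ : Cov d) : ℝ :=
  (n : ℝ) ^ (1 / (2 * r)) *
    (((predError r (empirical z) β₁).toReal - (predError r (empirical z) β₂).toReal
        + δ * ρ β₁ - δ * ρ β₂) / (2 * σ + ρ β₁ + ρ β₂))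

end RhoMSW

end

open RhoMSW

/-! ### Sizes of separated set families of bounded VC dimension. -/

section VapnikChervonenkis

open Finset
open scoped symmDiff

variable {κ : Type*} [DecidableEq κ]

/-! Under `worstCase` the residual of β is stretched proportionally, which is the equality case of
Minkowski's inequality. The worst-case error is therefore E_P[|Y - Xᵀβ|^r]^(1/r) + δ(σ + ρ(β))
(`predError_worstCase`). The null hypothesis thus orders the penalized errors under P, and the
numerator of T_n is at most the sum of the gaps between empirical and true error at β₁ and β₂.

These gaps are bounded for all γ at once, which is why the predictors may depend on the data. By
duality of norms the residual of γ oscillates over the support of P by at most K(σ + ρ(γ)) with K =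
c_{ρ,d} diam(supp P), a multiple of its share of the denominator. The tails of the residual are
probabilities of half-spaces. If P_n and P differ by at most ε on every half-space, the errors
differ by at most K(σ + ρ(γ))(2ε)^(1/r) (`abs_moment_le_add_of_discrepancy`), whence T_n ≤ K(2√n
ε)^(1/r) (`testStat_le`).

It remains to control √n ε. Half-spaces shatter at most d + 2 points, so symmetrization and Dudley's
chaining bound its mean by 32√(d+2) (`integral_maxDeviation_le_sqrt`). McDiarmid's inequality adds
√(log(1/α)/2) at level α. Twice the sum is at most 180√(d+2) + √(2 log(1/α)). -/

lemma card_image_inter_mul_pow_le {𝒜 : Finset (Finset κ)} {V : ℕ}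
    (hV : ∀ s, 𝒜.Shatters s → s.card ≤ V) (J : Finset κ) {x : ℝ} (hx0 : 0 < x) (hx1 : x ≤ 1) :
    ((𝒜.image (J ∩ ·)).card : ℝ) * x ^ V ≤ (1 + x) ^ J.card := by
  have hsub : (𝒜.image (J ∩ ·)).shatterer ⊆ J.powerset.filter (fun s => s.card ≤ V) := by
    intro s hs
    rw [mem_shatterer] at hs
    have hsJ : s ⊆ J := by
      obtain ⟨u, hu, hsu⟩ := hs.exists_superset
      obtain ⟨A, -, rfl⟩ := mem_image.1 hu
      exact hsu.trans inter_subset_left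
    refine mem_filter.2 ⟨mem_powerset.2 hsJ, hV s fun t ht => ?_⟩
    obtain ⟨u, hu, hsu⟩ := hs ht
    obtain ⟨A, hA, rfl⟩ := mem_image.1 hu
    refine ⟨A, hA, ?_⟩
    rw [← hsu, ← inter_assoc, inter_eq_left.2 hsJ]
  -- Sauer–Shelah in Pajor's form: a family has at most as many members as it shatters sets.
  have hcard : (𝒜.image (J ∩ ·)).card ≤ (J.powerset.filter (fun s => s.card ≤ V)).card :=
    (card_le_card_shatterer _).trans (card_le_card hsub)
  calc ((𝒜.image (J ∩ ·)).card : ℝ) * x ^ V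
      ≤ ((J.powerset.filter (fun s => s.card ≤ V)).card : ℝ) * x ^ V := by gcongr
    _ = ∑ s ∈ J.powerset.filter (fun s => s.card ≤ V), x ^ V := by simp
    -- The weight x ≤ 1 lets the truncated binomial sum be completed to (1 + x)^|J|; x is tuned
    -- later.
    _ ≤ ∑ s ∈ J.powerset.filter (fun s => s.card ≤ V), x ^ s.card :=
        sum_le_sum fun s hs => pow_le_pow_of_le_one hx0.le hx1 (mem_filter.1 hs).2
    _ ≤ ∑ s ∈ J.powerset, x ^ s.card :=
        sum_le_sum_of_subset_of_nonneg (filter_subset _ _) fun _ _ _ => by positivity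
    _ = (1 + x) ^ J.card := by
        rw [add_comm, ← sum_pow_mul_eq_add_pow]; simp

/-- A separated subfamily of largest cardinality is also a net, since an uncovered member could be
added to it. Separation will bound its size, covering will serve the chaining. -/
lemma exists_maximal_separated (𝒜 : Finset (Finset κ)) (h𝒜 : 𝒜.Nonempty) {m : ℝ} (hm : 0 ≤ m) :
    ∃ 𝒮 ⊆ 𝒜, 𝒮.Nonempty ∧ (∀ A ∈ 𝒮, ∀ B ∈ 𝒮, A ≠ B → m ≤ (A ∆ B).card) ∧
      ∀ A ∈ 𝒜, ∃ B ∈ 𝒮, ((A ∆ B).card : ℝ) ≤ m := by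
  classical
  let fam := 𝒜.powerset.filter fun 𝒮 => ∀ A ∈ 𝒮, ∀ B ∈ 𝒮, A ≠ B → m ≤ (A ∆ B).card
  have hfam : fam.Nonempty := ⟨∅, by simp [fam]⟩
  obtain ⟨𝒮, h𝒮, hmax⟩ := exists_max_image fam card hfam
  obtain ⟨hsub, hsep⟩ := mem_filter.1 h𝒮
  rw [mem_powerset] at hsub
  have hcov : ∀ A ∈ 𝒜, ∃ B ∈ 𝒮, ((A ∆ B).card : ℝ) ≤ m := by
    intro A hA
    by_cases hAS : A ∈ 𝒮
    · exact ⟨A, hAS, by simpa using hm⟩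
    by_contra! hcon
    have hins : insert A 𝒮 ∈ fam := by
      refine mem_filter.2 ⟨mem_powerset.2 (insert_subset hA hsub), ?_⟩
      intro C hC D hD hCD
      rcases mem_insert.1 hC with rfl | hC' <;> rcases mem_insert.1 hD with rfl | hD'
      · exact absurd rfl hCD
      · exact (hcon _ hD').le
      · rw [symmDiff_comm]; exact (hcon _ hC').le
      · exact hsep _ hC' _ hD' hCD
    have := hmax _ hins
    rw [card_insert_of_notMem hAS] at this
    omega
  refine ⟨𝒮, hsub, ?_, hsep, hcov⟩
  obtain ⟨A, hA⟩ := h𝒜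
  obtain ⟨B, hB, -⟩ := hcov A hA
  exact ⟨B, hB⟩

variable [Fintype κ]

/-- Some sample of `k` points of `κ` tells apart all members of a well separated family. -/
lemma exists_injOn_inter_of_separated {𝒮 : Finset (Finset κ)} {ε : ℝ}
    (hε1 : ε ≤ 1)
    (hsep : ∀ A ∈ 𝒮, ∀ B ∈ 𝒮, A ≠ B → ε * Fintype.card κ ≤ (A ∆ B).card)
    {k : ℕ} (hκ : 0 < Fintype.card κ) (hk : (𝒮.card : ℝ) ^ 2 * (1 - ε) ^ k < 1) :
    ∃ J : Finset κ, J.card ≤ k ∧ Set.InjOn (J ∩ ·) (𝒮 : Set (Finset κ)) := by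
  classical
  set n := Fintype.card κ with hn
  -- First-moment argument: k points drawn uniformly with replacement all miss a given symmetric
  -- difference with probability at most (1 - ε)^k. The expected number of pairs not told apart is
  -- below 1, so some draw has none.
  let bad : (Fin k → κ) → Finset (Finset κ × Finset κ) := fun φ =>
    𝒮.offDiag.filter fun p => ∀ i, φ i ∉ p.1 ∆ p.2
  have hcount : ∑ φ : Fin k → κ, ((bad φ).card : ℝ) < ∑ φ : Fin k → κ, (1 : ℝ) := by
    have h1 : ∑ φ : Fin k → κ, ((bad φ).card : ℝ)
        = ∑ p ∈ 𝒮.offDiag, ((univ.filter fun φ : Fin k → κ => ∀ i, φ i ∉ p.1 ∆ p.2).card : ℝ) := by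
      simp only [bad, card_filter, Nat.cast_sum]
      rw [sum_comm]
    have h2 : ∀ p ∈ 𝒮.offDiag,
        ((univ.filter fun φ : Fin k → κ => ∀ i, φ i ∉ p.1 ∆ p.2).card : ℝ)
          ≤ (n * (1 - ε)) ^ k := by
      intro p hp
      obtain ⟨hA, hB, hAB⟩ := mem_offDiag.1 hp
      have : (univ.filter fun φ : Fin k → κ => ∀ i, φ i ∉ p.1 ∆ p.2)
          = Fintype.piFinset fun _ : Fin k => (p.1 ∆ p.2)ᶜ := by
        ext φ; simp only [mem_filter, mem_univ, true_and, Fintype.mem_piFinset, mem_compl]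
      rw [this, Fintype.card_piFinset_const, Nat.cast_pow]
      gcongr
      rw [card_compl, Nat.cast_sub (card_le_univ _)]
      have := hsep _ hA _ hB hAB
      linarith
    have hn' : (0 : ℝ) < n := by exact_mod_cast hκ
    have h3 : (0 : ℝ) ≤ (n * (1 - ε)) ^ k := by
      have : 0 ≤ 1 - ε := by linarith
      positivity
    have h4 : (𝒮.offDiag.card : ℝ) ≤ (𝒮.card : ℝ) ^ 2 := by
      rw [offDiag_card, sq]
      exact_mod_cast Nat.sub_le _ _
    calc ∑ φ : Fin k → κ, ((bad φ).card : ℝ) ≤ ∑ p ∈ 𝒮.offDiag, (n * (1 - ε)) ^ k := by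
          rw [h1]; exact sum_le_sum h2
      _ = 𝒮.offDiag.card * (n * (1 - ε)) ^ k := by simp
      _ ≤ (𝒮.card : ℝ) ^ 2 * (n * (1 - ε)) ^ k := by gcongr
      _ = n ^ k * ((𝒮.card : ℝ) ^ 2 * (1 - ε) ^ k) := by rw [mul_pow]; ring
      _ < n ^ k * 1 := by gcongr
      _ = ∑ φ : Fin k → κ, (1 : ℝ) := by simp [hn]
  obtain ⟨φ, -, hφ⟩ := exists_lt_of_sum_lt hcount
  have hφ0 : bad φ = ∅ := by
    rw [← card_eq_zero]
    have : (bad φ).card < 1 := by exact_mod_cast hφ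
    omega
  refine ⟨univ.image φ, by simpa using card_image_le (s := univ) (f := φ), ?_⟩
  intro A hA B hB hAB
  by_contra hne
  have hmem : (A, B) ∈ bad φ := by
    refine mem_filter.2 ⟨mem_offDiag.2 ⟨hA, hB, hne⟩, fun i hi => ?_⟩
    have hi' := congrArg (φ i ∈ ·) hAB
    simp only [mem_inter, mem_image, mem_univ, true_and, exists_apply_eq_apply, eq_iff_iff] at hi'
    rw [mem_symmDiff] at hi
    tauto
  simp [hφ0] at hmem

/-- Dudley's bound for the size of a separated family of bounded VC dimension. -/
lemma log_card_le_of_separated {𝒮 : Finset (Finset κ)} {V : ℕ}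
    (hV : ∀ s, 𝒮.Shatters s → s.card ≤ V) {ε : ℝ} (hε0 : 0 < ε) (hε1 : ε ≤ 1)
    (hsep : ∀ A ∈ 𝒮, ∀ B ∈ 𝒮, A ≠ B → ε * Fintype.card κ ≤ (A ∆ B).card)
    (hκ : 0 < Fintype.card κ) (hne : 𝒮.Nonempty) :
    Real.log 𝒮.card ≤ 2 * V * Real.log (4 / ε) + 1 / 2 := by
  have hN : (0 : ℝ) < 𝒮.card := by exact_mod_cast hne.card_pos
  have hN1 : (1 : ℝ) ≤ 𝒮.card := by exact_mod_cast hne.card_pos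
  have hlog : 0 ≤ Real.log 𝒮.card := Real.log_nonneg hN1
  set y := Real.log 𝒮.card with hy
  -- The least k with εk > 2y, which makes N² e^(-εk) < 1 for N = e^y.
  set k := ⌊2 * y / ε⌋₊ + 1 with hk
  have hk1 : 2 * y / ε < k := by
    rw [hk]; push_cast; exact Nat.lt_floor_add_one _
  have hk2 : (k : ℝ) ≤ 2 * y / ε + 1 := by
    rw [hk]; push_cast
    gcongr
    exact Nat.floor_le (by positivity)
  have hsmall : (𝒮.card : ℝ) ^ 2 * (1 - ε) ^ k < 1 := by
    have e1 : (𝒮.card : ℝ) = Real.exp y := by rw [hy, Real.exp_log hN]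
    have e2 : (1 - ε) ^ k ≤ Real.exp (-ε) ^ k := by
      gcongr
      have := Real.add_one_le_exp (-ε); linarith
    calc (𝒮.card : ℝ) ^ 2 * (1 - ε) ^ k ≤ Real.exp y ^ 2 * Real.exp (-ε) ^ k := by
          rw [e1]; gcongr
      _ = Real.exp (2 * y - ε * k) := by
          rw [← Real.exp_nat_mul, ← Real.exp_nat_mul, ← Real.exp_add]; congr 1; push_cast; ring
      _ < 1 := by
          rw [Real.exp_lt_one_iff]
          rw [div_lt_iff₀ hε0] at hk1
          linarith
  obtain ⟨J, hJ, hinj⟩ := exists_injOn_inter_of_separated hε1 hsep hκ hsmall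
  -- With x = ε/4 the bound (1 + x)^k ≤ e^(εk/4) costs only y/2 + ε/4 in the exponent, so half of y
  -- is absorbed on the left.
  have hx0 : 0 < ε / 4 := by positivity
  have h := card_image_inter_mul_pow_le hV J hx0 (by linarith)
  rw [card_image_of_injOn hinj] at h
  have h' : (𝒮.card : ℝ) * (ε / 4) ^ V ≤ Real.exp (ε / 4 * k) := by
    refine h.trans ?_
    calc (1 + ε / 4) ^ J.card ≤ (1 + ε / 4) ^ k := pow_le_pow_right₀ (by linarith) hJ
      _ ≤ Real.exp (ε / 4) ^ k := by
          gcongr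
          have := Real.add_one_le_exp (ε / 4); linarith
      _ = Real.exp (ε / 4 * k) := by rw [← Real.exp_nat_mul]; congr 1; ring
  have h'' := Real.log_le_log (by positivity) h'
  rw [Real.log_exp, Real.log_mul hN.ne' (by positivity), Real.log_pow] at h''
  have h3 : Real.log (ε / 4) = - Real.log (4 / ε) := by rw [← Real.log_inv, inv_div]
  rw [h3] at h''
  have h4 : ε / 4 * k ≤ ε / 4 * (2 * y / ε + 1) := by gcongr
  have h5 : ε / 4 * (2 * y / ε + 1) = y / 2 + ε / 4 := by field_simp; ring
  nlinarith

end VapnikChervonenkis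

/-! ### Rademacher averages and Dudley's chaining. -/

section Rademacher

open Finset
open scoped symmDiff

variable {κ : Type*} [Fintype κ]

/-- The sign `±1` encoded by a Boolean. -/
noncomputable def boolSign (b : Bool) : ℝ := if b then 1 else -1

/-- The Rademacher sum `∑ i, s i * c i`. -/
noncomputable def radSum (s : κ → Bool) (c : κ → ℝ) : ℝ := ∑ i, boolSign (s i) * c i

lemma radSum_neg (s : κ → Bool) (c : κ → ℝ) : radSum s (fun i => - c i) = - radSum s c := by
  simp [radSum]

lemma radSum_sub (s : κ → Bool) (c d : κ → ℝ) :
    radSum s (fun i => c i - d i) = radSum s c - radSum s d := by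
  simp [radSum, mul_sub]

variable [DecidableEq κ]

/-- The average of `f` over all choices of signs. -/
noncomputable def signAvg (f : (κ → Bool) → ℝ) : ℝ := ∑ s, (2 ^ Fintype.card κ : ℝ)⁻¹ * f s

lemma signAvg_mono {f g : (κ → Bool) → ℝ} (h : ∀ s, f s ≤ g s) : signAvg f ≤ signAvg g :=
  sum_le_sum fun s _ => mul_le_mul_of_nonneg_left (h s) (by positivity)

lemma signAvg_add (f g : (κ → Bool) → ℝ) :
    signAvg (fun s => f s + g s) = signAvg f + signAvg g := by
  simp [signAvg, mul_add, sum_add_distrib]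

lemma signAvg_mul (a : ℝ) (f : (κ → Bool) → ℝ) :
    signAvg (fun s => a * f s) = a * signAvg f := by
  simp only [signAvg, mul_sum]
  exact sum_congr rfl fun _ _ => by ring

lemma sum_signAvg {ι : Type*} (T : Finset ι) (f : ι → (κ → Bool) → ℝ) :
    signAvg (fun s => ∑ t ∈ T, f t s) = ∑ t ∈ T, signAvg (f t) := by
  simp only [signAvg, mul_sum]
  rw [sum_comm]

lemma signAvg_const (a : ℝ) : signAvg (fun _ : κ → Bool => a) = a := by
  simp [signAvg]

/-- Independence of the signs factors the average into a product of cosh(l cᵢ), and cosh x ≤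
e^(x²/2). -/
lemma signAvg_exp_radSum_le (c : κ → ℝ) (l : ℝ) :
    signAvg (fun s => Real.exp (l * radSum s c)) ≤ Real.exp (l ^ 2 * (∑ i, c i ^ 2) / 2) := by
  have h1 : signAvg (fun s => Real.exp (l * radSum s c)) = ∏ i, Real.cosh (l * c i) := by
    have : ∀ i, Real.cosh (l * c i)
        = ∑ b : Bool, (2 : ℝ)⁻¹ * Real.exp (l * (boolSign b * c i)) := by
      intro i
      rw [Real.cosh_eq, Fintype.sum_bool]
      simp [boolSign]; ring
    simp_rw [this]
    rw [Finset.prod_univ_sum, Fintype.piFinset_univ]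
    refine sum_congr rfl fun s _ => ?_
    simp only [radSum, mul_sum]
    rw [prod_mul_distrib, ← Real.exp_sum]
    simp
  rw [h1]
  calc ∏ i, Real.cosh (l * c i) ≤ ∏ i, Real.exp ((l * c i) ^ 2 / 2) :=
        prod_le_prod (fun i _ => (Real.cosh_pos _).le) fun i _ => Real.cosh_le_exp_half_sq _
    _ = Real.exp (l ^ 2 * (∑ i, c i ^ 2) / 2) := by
        rw [← Real.exp_sum, mul_sum, sum_div]
        congr 1
        exact sum_congr rfl fun i _ => by ring

lemma exp_signAvg_le (f : (κ → Bool) → ℝ) :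
    Real.exp (signAvg f) ≤ signAvg fun s => Real.exp (f s) := by
  have := convexOn_exp.map_sum_le (t := (univ : Finset (κ → Bool)))
    (w := fun _ => (2 ^ Fintype.card κ : ℝ)⁻¹) (p := f) (fun _ _ => by positivity)
    (by simp) (fun _ _ => Set.mem_univ _)
  simpa [signAvg] using this

/-- The maximal inequality for finitely many Rademacher sums. -/
lemma signAvg_sup_abs_radSum_le {ι : Type*} (T : Finset ι) (hT : T.Nonempty) (c : ι → κ → ℝ)
    {v b : ℝ} (hv : 0 < v) (hc : ∀ t ∈ T, ∑ i, c t i ^ 2 ≤ v)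
    (hb : 0 < b) (hTb : Real.log (2 * T.card) ≤ b) :
    signAvg (fun s => T.sup' hT fun t => |radSum s (c t)|) ≤ √(2 * v * b) := by
  set M : (κ → Bool) → ℝ := fun s => T.sup' hT fun t => |radSum s (c t)| with hM
  -- The choice l²v/2 = b balances the two contributions: the exponential bound is e^(2b), and 2b/l
  -- = √(2vb).
  set l := √(2 * b / v) with hl
  have hl0 : 0 < l := Real.sqrt_pos.2 (by positivity)
  have hl2 : l ^ 2 = 2 * b / v := Real.sq_sqrt (by positivity)
  have hbound : ∀ t ∈ T, signAvg (fun s => Real.exp (l * |radSum s (c t)|)) ≤ 2 * Real.exp b := by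
    intro t ht
    have hle : ∀ s, Real.exp (l * |radSum s (c t)|)
        ≤ Real.exp (l * radSum s (c t)) + Real.exp (l * radSum s (fun i => - c t i)) := by
      intro s
      rw [radSum_neg]
      rcases abs_cases (radSum s (c t)) with ⟨h, -⟩ | ⟨h, -⟩ <;> rw [h]
      · linarith [Real.exp_pos (l * -radSum s (c t))]
      · linarith [Real.exp_pos (l * radSum s (c t))]
    have hexp : Real.exp (l ^ 2 * (∑ i, c t i ^ 2) / 2) ≤ Real.exp b := by
      rw [Real.exp_le_exp, hl2]
      calc 2 * b / v * (∑ i, c t i ^ 2) / 2 ≤ 2 * b / v * v / 2 := by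
            gcongr; exact hc t ht
        _ = b := by field_simp
    calc _ ≤ _ := signAvg_mono hle
      _ = _ := signAvg_add _ _
      _ ≤ Real.exp b + Real.exp b := by
          refine add_le_add ((signAvg_exp_radSum_le _ _).trans hexp)
            ((signAvg_exp_radSum_le _ _).trans ?_)
          simpa using hexp
      _ = 2 * Real.exp b := by ring
  have hN : (0 : ℝ) < T.card := by exact_mod_cast hT.card_pos
  have h1 : Real.exp (l * signAvg M) ≤ Real.exp (2 * b) := by
    calc Real.exp (l * signAvg M) = Real.exp (signAvg fun s => l * M s) := by rw [signAvg_mul]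
      _ ≤ signAvg fun s => Real.exp (l * M s) := exp_signAvg_le _
      _ ≤ signAvg fun s => ∑ t ∈ T, Real.exp (l * |radSum s (c t)|) := by
          refine signAvg_mono fun s => ?_
          obtain ⟨t, ht, hts⟩ := exists_mem_eq_sup' hT fun t => |radSum s (c t)|
          rw [hM]
          simp only [hts]
          exact single_le_sum (f := fun t => Real.exp (l * |radSum s (c t)|))
            (fun _ _ => (Real.exp_pos _).le) ht
      _ = ∑ t ∈ T, signAvg fun s => Real.exp (l * |radSum s (c t)|) := sum_signAvg _ _
      _ ≤ ∑ t ∈ T, 2 * Real.exp b := sum_le_sum hbound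
      _ = (2 * T.card) * Real.exp b := by simp; ring
      _ ≤ Real.exp b * Real.exp b := by
          gcongr
          rwa [← Real.log_le_iff_le_exp (by positivity)]
      _ = Real.exp (2 * b) := by rw [← Real.exp_add]; ring_nf
  rw [Real.exp_le_exp] at h1
  have h2 : signAvg M ≤ 2 * b / l := by rw [le_div_iff₀ hl0]; linarith
  refine h2.trans (Real.le_sqrt_of_sq_le ?_)
  rw [div_pow, hl2]
  apply le_of_eq
  field_simp

/-- The indicator function of a finite set, with real values. -/
noncomputable def finInd (A : Finset κ) (i : κ) : ℝ := if i ∈ A then 1 else 0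

/-- Hamming distance is squared Euclidean distance of indicators: Hamming scale 4^(-j) n means
Euclidean radius 2^(-j) √n. -/
lemma sum_finInd_sub_sq (A B : Finset κ) :
    ∑ i, (finInd A i - finInd B i) ^ 2 = (A ∆ B).card := by
  have : ∀ i, (finInd A i - finInd B i) ^ 2 = if i ∈ A ∆ B then 1 else 0 := by
    intro i
    by_cases hA : i ∈ A <;> by_cases hB : i ∈ B <;> simp [finInd, hA, hB, mem_symmDiff]
  simp [this]

/-- `log_card_le_of_separated` at ε = 4^(-j); the factor 2 accounts for both signs of each
Rademacher sum. The constants come from 4 log 2 < 2.8 and log 2 + 1/2 < 1.2. -/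
lemma log_two_mul_card_le {𝒮 : Finset (Finset κ)} {V : ℕ} (hV1 : 1 ≤ V)
    (hV : ∀ s, 𝒮.Shatters s → s.card ≤ V) (j : ℕ)
    (hsep : ∀ A ∈ 𝒮, ∀ B ∈ 𝒮, A ≠ B → (4 ^ j : ℝ)⁻¹ * Fintype.card κ ≤ (A ∆ B).card)
    (hκ : 0 < Fintype.card κ) (hne : 𝒮.Nonempty) :
    Real.log (2 * 𝒮.card) ≤ V * (3 * j + 4) := by
  have h := log_card_le_of_separated hV (by positivity) (inv_le_one_of_one_le₀
    (one_le_pow₀ (by norm_num))) hsep hκ hne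
  have hN : (0 : ℝ) < 𝒮.card := by exact_mod_cast hne.card_pos
  rw [Real.log_mul (by norm_num) hN.ne']
  have h4 : Real.log (4 / (4 ^ j : ℝ)⁻¹) = (j + 1) * (2 * Real.log 2) := by
    rw [div_inv_eq_mul, ← pow_succ', Real.log_pow,
      show (4 : ℝ) = 2 ^ 2 by norm_num, Real.log_pow]
    push_cast; ring
  rw [h4] at h
  have hl := Real.log_two_lt_d9
  have hl0 := Real.log_pos (show (1 : ℝ) < 2 by norm_num)
  have hV' : (1 : ℝ) ≤ V := by exact_mod_cast hV1
  have hj : (0 : ℝ) ≤ j := by positivity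
  have h5 : (2 * V * ((j + 1) * (2 * Real.log 2)) : ℝ) ≤ V * (2.8 * (j + 1)) := by
    have : (j + 1) * (4 * Real.log 2) ≤ (j + 1 : ℝ) * 2.8 := by gcongr; linarith
    nlinarith
  nlinarith

/-- Dudley's chaining bound over a net at scale `4 ^ (-j)`. -/
lemma signAvg_sup_net_le {𝒜 : Finset (Finset κ)} {V : ℕ} (hV1 : 1 ≤ V)
    (hV : ∀ s, 𝒜.Shatters s → s.card ≤ V) (hκ : 0 < Fintype.card κ)
    (𝒮 : ℕ → Finset (Finset κ)) (hsub : ∀ j, 𝒮 j ⊆ 𝒜) (hne : ∀ j, (𝒮 j).Nonempty)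
    (hsep : ∀ j, ∀ A ∈ 𝒮 j, ∀ B ∈ 𝒮 j, A ≠ B →
      (4 ^ j : ℝ)⁻¹ * Fintype.card κ ≤ (A ∆ B).card)
    (hcov : ∀ j, ∀ A ∈ 𝒜, ∃ B ∈ 𝒮 j, ((A ∆ B).card : ℝ) ≤ (4 ^ j : ℝ)⁻¹ * Fintype.card κ)
    (j : ℕ) :
    signAvg (fun s => (𝒮 j).sup' (hne j) fun A => |radSum s (finInd A)|)
      ≤ √(Fintype.card κ * V) * (16 - (4 * j + 12) / 2 ^ j) := by
  have hcard : ∀ j, Real.log (2 * (𝒮 j).card) ≤ V * (3 * j + 4) := fun j =>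
    log_two_mul_card_le hV1 (fun s hs => hV s (hs.mono_left (hsub j))) j (hsep j) hκ (hne j)
  have hκ' : (0 : ℝ) < Fintype.card κ := by exact_mod_cast hκ
  have hV' : (0 : ℝ) < V := by exact_mod_cast hV1
  -- The subtracted (4j + 12)/2^j is the tail ∑_{i ≥ j} (2i + 4)/2^i of the link bounds still to
  -- come. All links sum to 12, and the coarsest net contributes √8 ≤ 4.
  induction j with
  | zero =>
    have h := signAvg_sup_abs_radSum_le (𝒮 0) (hne 0) finInd hκ' (fun A _ => by
      have := sum_finInd_sub_sq A ∅
      simp only [finInd, notMem_empty, if_false, sub_zero] at this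
      simp only [finInd, this]
      exact_mod_cast card_le_univ _) (by positivity) (hcard 0)
    refine h.trans ?_
    rw [show (2 * (Fintype.card κ : ℝ) * (V * (3 * (0 : ℕ) + 4))) = (Fintype.card κ * V) * 8 by
      push_cast; ring, Real.sqrt_mul (by positivity)]
    gcongr
    rw [Real.sqrt_le_left (by norm_num)]
    norm_num
  | succ j ih =>
    -- Each member of the finer net is linked to a near member of the coarser one, so there are at
    -- most as many increments as members of the finer net.
    choose! π hπ hπd using hcov j
    have h := signAvg_sup_abs_radSum_le (𝒮 (j + 1)) (hne _)
      (fun A i => finInd A i - finInd (π A) i) (v := (4 ^ j : ℝ)⁻¹ * Fintype.card κ)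
      (by positivity)
      (fun A hA => by rw [sum_finInd_sub_sq]; exact hπd A (hsub _ hA)) (by positivity)
      (hcard (j + 1))
    have hle : ∀ s, ((𝒮 (j + 1)).sup' (hne (j + 1)) fun A => |radSum s (finInd A)|)
        ≤ ((𝒮 j).sup' (hne j) fun A => |radSum s (finInd A)|)
          + (𝒮 (j + 1)).sup' (hne _) fun A =>
            |radSum s (fun i => finInd A i - finInd (π A) i)| := by
      intro s
      refine sup'_le _ _ fun A hA => ?_
      have h1 := le_sup' (fun A => |radSum s (finInd A)|) (hπ A (hsub _ hA))
      have h2 := le_sup' (fun A => |radSum s (fun i => finInd A i - finInd (π A) i)|) hA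
      rw [radSum_sub] at h2
      have h3 := abs_sub_abs_le_abs_sub (radSum s (finInd A)) (radSum s (finInd (π A)))
      linarith
    -- Reduces to 6j + 14 ≤ (2j + 4)².
    have h4 : √(2 * ((4 ^ j : ℝ)⁻¹ * Fintype.card κ) * (V * (3 * (j + 1 : ℕ) + 4)))
        ≤ √(Fintype.card κ * V) * ((2 * j + 4) / 2 ^ j) := by
      rw [show (2 * ((4 ^ j : ℝ)⁻¹ * Fintype.card κ) * (V * (3 * (j + 1 : ℕ) + 4)))
        = (Fintype.card κ * V) * ((4 ^ j : ℝ)⁻¹ * (6 * j + 14)) by push_cast; ring,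
        Real.sqrt_mul (by positivity)]
      gcongr
      rw [Real.sqrt_le_left (by positivity), div_pow, ← pow_mul, mul_comm j 2, pow_mul,
        show (2 : ℝ) ^ 2 = 4 by norm_num, inv_mul_eq_div]
      gcongr
      nlinarith [(Nat.cast_nonneg j : (0 : ℝ) ≤ j)]
    calc _ ≤ _ := signAvg_mono hle
      _ = _ := signAvg_add _ _
      _ ≤ √(Fintype.card κ * V) * (16 - (4 * j + 12) / 2 ^ j)
          + √(Fintype.card κ * V) * ((2 * j + 4) / 2 ^ j) := add_le_add ih (h.trans h4)
      _ = _ := by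
          rw [← mul_add]
          congr 1
          push_cast
          rw [pow_succ]
          field_simp
          ring

/-- The average over signs of the maximal Rademacher sum over a family of VC dimension at most `V`
is at most `16 √(n V)`. -/
theorem signAvg_sup_abs_radSum_finInd_le {𝒜 : Finset (Finset κ)} {V : ℕ} (hV1 : 1 ≤ V)
    (hV : ∀ s, 𝒜.Shatters s → s.card ≤ V) (hκ : 0 < Fintype.card κ) (hne : 𝒜.Nonempty) :
    signAvg (fun s => 𝒜.sup' hne fun A => |radSum s (finInd A)|)
      ≤ 16 * √(Fintype.card κ * V) := by
  have hnet := fun j : ℕ => exists_maximal_separated 𝒜 hne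
    (m := (4 ^ j : ℝ)⁻¹ * Fintype.card κ) (by positivity)
  choose 𝒮 hsub hSne hsep hcov using hnet
  obtain ⟨J, hJ⟩ := pow_unbounded_of_one_lt (Fintype.card κ : ℝ) (show (1 : ℝ) < 4 by norm_num)
  -- Below scale 1 a symmetric difference is empty, so this net is the whole family and the chain is
  -- finite.
  have hall : 𝒜 ⊆ 𝒮 J := by
    intro A hA
    obtain ⟨B, hB, hAB⟩ := hcov J A hA
    have h1 : ((A ∆ B).card : ℝ) < 1 := by
      refine hAB.trans_lt ?_
      rw [inv_mul_eq_div, div_lt_one (by positivity)]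
      exact hJ
    have h2 : A ∆ B = ∅ := by
      rw [← card_eq_zero]
      have : (A ∆ B).card < 1 := by exact_mod_cast h1
      omega
    rw [symmDiff_eq_empty.1 h2]
    exact hB
  have h := signAvg_sup_net_le hV1 hV hκ 𝒮 hsub hSne hsep hcov J
  refine (signAvg_mono fun s => sup'_mono _ hall hne).trans (h.trans ?_)
  rw [mul_comm 16]
  gcongr
  have : (0 : ℝ) ≤ (4 * J + 12) / 2 ^ J := by positivity
  linarith

end Rademacher

/-! ### McDiarmid's inequality. -/

section BoundedDifferences

variable {X : Type*} [MeasurableSpace X] (P : Measure X) [IsProbabilityMeasure P]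

lemma integrable_of_measurable_of_abs_le {Y : Type*} [MeasurableSpace Y] {Q : Measure Y}
    [IsFiniteMeasure Q] {f : Y → ℝ} (hf : Measurable f) {M : ℝ} (hM : ∀ x, |f x| ≤ M) :
    Integrable f Q :=
  Integrable.of_bound hf.aestronglyMeasurable M (Filter.Eventually.of_forall hM)

/-- Hoeffding's lemma for a bounded function of oscillation at most `c`. -/
lemma integral_exp_sub_integral_le {f : X → ℝ} (hf : Measurable f) {M : ℝ} (hM : ∀ x, |f x| ≤ M)
    {c : ℝ} (hc0 : 0 ≤ c) (hc : ∀ x y, f x - f y ≤ c) (l : ℝ) :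
    ∫ x, Real.exp (l * (f x - ∫ y, f y ∂P)) ∂P ≤ Real.exp (l ^ 2 * c ^ 2 / 8) := by
  have hX : Nonempty X := nonempty_of_isProbabilityMeasure P
  have hbdd : BddBelow (Set.range f) := ⟨-M, by
    rintro _ ⟨x, rfl⟩; exact (abs_le.1 (hM x)).1⟩
  have hmem : ∀ x, f x ∈ Set.Icc (⨅ y, f y) ((⨅ y, f y) + c) := fun x =>
    ⟨ciInf_le hbdd x, by
      rw [← sub_le_iff_le_add]
      exact le_ciInf fun y => by linarith [hc x y]⟩
  have h := (hasSubgaussianMGF_of_mem_Icc hf.aemeasurable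
    (Filter.Eventually.of_forall hmem) (μ := P)).mgf_le l
  refine h.trans (le_of_eq ?_)
  congr 1
  simp [abs_of_nonneg hc0]
  ring

/-- Exponential moments under the bounded difference condition (McDiarmid). -/
theorem integral_exp_sub_integral_pi_le {c : ℝ} (hc0 : 0 ≤ c) (l : ℝ) (n : ℕ) :
    ∀ f : (Fin n → X) → ℝ, Measurable f → ∀ M : ℝ, (∀ x, |f x| ≤ M) →
      (∀ x i y, f (Function.update x i y) - f x ≤ c) →
      ∫ x, Real.exp (l * (f x - ∫ y, f y ∂Measure.pi fun _ => P)) ∂Measure.pi (fun _ => P)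
        ≤ Real.exp (n * (l ^ 2 * c ^ 2 / 8)) := by
  induction n with
  | zero =>
    intro f hf M hM hc
    have hx : ∀ x : Fin 0 → X, f x = f (fun i => i.elim0) := fun x => by
      congr 1; exact Subsingleton.elim _ _
    have : ∀ x : Fin 0 → X, f x - ∫ y, f y ∂Measure.pi (fun _ => P) = 0 := by
      intro x
      simp_rw [hx]
      simp
    simp [this]
  | succ n ih =>
    intro f hf M hM hc
    set Q := Measure.pi fun _ : Fin n => P with hQ
    have hmp := (measurePreserving_piFinSuccAbove (fun _ : Fin (n + 1) => P) 0).symm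
    have hcons : ∀ p : X × (Fin n → X),
        (MeasurableEquiv.piFinSuccAbove (fun _ : Fin (n + 1) => X) 0).symm p
          = (Fin.cons p.1 p.2 : Fin (n + 1) → X) := by
      intro p
      simp [MeasurableEquiv.piFinSuccAbove, Fin.insertNthEquiv]
    have hmeas : Measurable fun p : X × (Fin n → X) => f (Fin.cons p.1 p.2 : Fin (n + 1) → X) := by
      have h := hf.comp hmp.measurable
      have he : (f ∘ (MeasurableEquiv.piFinSuccAbove (fun _ : Fin (n + 1) => X) 0).symm)
          = fun p => f (Fin.cons p.1 p.2 : Fin (n + 1) → X) :=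
        funext fun p => congrArg f (hcons p)
      rwa [he] at h
    have hint : ∀ h : (Fin (n + 1) → X) → ℝ, ∫ x, h x ∂Measure.pi (fun _ => P)
        = ∫ p, h (Fin.cons p.1 p.2 : Fin (n + 1) → X) ∂(P.prod Q) := by
      intro h
      rw [← hmp.integral_comp (MeasurableEquiv.measurableEmbedding _)]
      simp_rw [hcons]
      rfl
    -- Integrating out the first coordinate splits f - E f into (f - g) + (g - E g). Hoeffding's
    -- lemma handles the first term with the other coordinates fixed; g inherits the bounded
    -- differences, so induction handles the second.
    set g : (Fin n → X) → ℝ := fun xs => ∫ x, f (Fin.cons x xs : Fin (n + 1) → X) ∂P with hg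
    have hgm : Measurable g := by
      exact (hmeas.stronglyMeasurable.integral_prod_left' (μ := P)).measurable
    have hsec : ∀ xs, Measurable fun x => f (Fin.cons x xs : Fin (n + 1) → X) := fun xs =>
      hmeas.comp (measurable_id.prodMk measurable_const)
    have hsecint : ∀ xs, Integrable (fun x => f (Fin.cons x xs : Fin (n + 1) → X)) P := fun xs =>
      integrable_of_measurable_of_abs_le (hsec xs) fun x => hM _
    have hgM : ∀ xs, |g xs| ≤ M := by
      intro xs
      have := norm_integral_le_of_norm_le_const (μ := P)
        (f := fun x => f (Fin.cons x xs : Fin (n + 1) → X)) (Filter.Eventually.of_forall fun x => hM _)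
      simpa using this
    have hgc : ∀ x i y, g (Function.update x i y) - g x ≤ c := by
      intro xs i y
      rw [hg]
      simp only
      rw [← integral_sub (hsecint _) (hsecint _)]
      refine (integral_mono ((hsecint _).sub (hsecint _)) (integrable_const c) fun x => ?_).trans
        (by simp)
      have := hc (Fin.cons x xs : Fin (n + 1) → X) i.succ y
      rwa [← Fin.cons_update] at this
    have hfg : ∫ x, f x ∂Measure.pi (fun _ => P) = ∫ xs, g xs ∂Q := by
      rw [hint, integral_prod_symm]
      exact integrable_of_measurable_of_abs_le hmeas fun p => hM _
    rw [hint, hfg]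
    set m := ∫ xs, g xs ∂Q with hm
    have hmM : |m| ≤ M := by
      have := norm_integral_le_of_norm_le_const (μ := Q) (f := g)
        (Filter.Eventually.of_forall hgM)
      simpa using this
    have habs : ∀ u v : ℝ, |u| ≤ M → |v| ≤ M →
        |Real.exp (l * (u - v))| ≤ Real.exp (|l| * (M + M)) := by
      intro u v hu hv
      rw [abs_of_pos (Real.exp_pos _), Real.exp_le_exp]
      calc l * (u - v) ≤ |l * (u - v)| := le_abs_self _
        _ = |l| * |u - v| := abs_mul _ _
        _ ≤ |l| * (M + M) := by
            gcongr
            exact (abs_sub _ _).trans (add_le_add hu hv)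
    have hEint : Integrable (fun p : X × (Fin n → X) =>
        Real.exp (l * (f (Fin.cons p.1 p.2 : Fin (n + 1) → X) - m))) (P.prod Q) :=
      integrable_of_measurable_of_abs_le ((hmeas.sub_const m).const_mul l).exp fun p => habs _ _ (hM _) hmM
    rw [integral_prod_symm _ hEint]
    have hinner : ∀ xs, ∫ x, Real.exp (l * (f (Fin.cons x xs : Fin (n + 1) → X) - m)) ∂P
        ≤ Real.exp (l * (g xs - m)) * Real.exp (l ^ 2 * c ^ 2 / 8) := by
      intro xs
      have h1 : ∀ x, Real.exp (l * (f (Fin.cons x xs : Fin (n + 1) → X) - m))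
          = Real.exp (l * (g xs - m))
            * Real.exp (l * (f (Fin.cons x xs : Fin (n + 1) → X) - g xs)) := by
        intro x; rw [← Real.exp_add]; congr 1; ring
      simp_rw [h1]
      rw [integral_const_mul]
      gcongr
      refine integral_exp_sub_integral_le P (hsec xs) (fun x => hM _) hc0 (fun x y => ?_) l
      have := hc (Fin.cons y xs : Fin (n + 1) → X) 0 x
      rwa [Fin.update_cons_zero] at this
    calc ∫ xs, ∫ x, Real.exp (l * (f (Fin.cons x xs : Fin (n + 1) → X) - m)) ∂P ∂Q
        ≤ ∫ xs, Real.exp (l * (g xs - m)) * Real.exp (l ^ 2 * c ^ 2 / 8) ∂Q := by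
          refine integral_mono hEint.integral_prod_right ?_ hinner
          exact (integrable_of_measurable_of_abs_le (by fun_prop)
            fun xs => habs _ _ (hgM xs) hmM).mul_const _
      _ = (∫ xs, Real.exp (l * (g xs - m)) ∂Q) * Real.exp (l ^ 2 * c ^ 2 / 8) :=
          integral_mul_const _ _
      _ ≤ Real.exp (n * (l ^ 2 * c ^ 2 / 8)) * Real.exp (l ^ 2 * c ^ 2 / 8) := by
          gcongr
          exact ih g hgm M hgM hgc
      _ = _ := by rw [← Real.exp_add]; congr 1; push_cast; ring

/-- **McDiarmid's inequality**. -/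
theorem measureReal_pi_add_le_of_bounded_differences {n : ℕ} {c : ℝ} (hc0 : 0 ≤ c)
    {f : (Fin n → X) → ℝ} (hf : Measurable f) {M : ℝ} (hM : ∀ x, |f x| ≤ M)
    (hc : ∀ x i y, f (Function.update x i y) - f x ≤ c) {t : ℝ} (ht : 0 ≤ t) :
    (Measure.pi fun _ : Fin n => P).real {x | (∫ y, f y ∂Measure.pi fun _ => P) + t ≤ f x}
      ≤ Real.exp (-(2 * t ^ 2 / (n * c ^ 2))) := by
  set Q := Measure.pi fun _ : Fin n => P
  set m := ∫ y, f y ∂Q with hm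
  have hsub : HasSubgaussianMGF (fun x => f x - m) ⟨n * c ^ 2 / 4, by positivity⟩ Q := by
    constructor
    · intro l
      refine integrable_of_measurable_of_abs_le (M := Real.exp (|l| * (M + |m|))) (by fun_prop)
        fun x => ?_
      rw [abs_of_pos (Real.exp_pos _), Real.exp_le_exp]
      calc l * (f x - m) ≤ |l * (f x - m)| := le_abs_self _
        _ = |l| * |f x - m| := abs_mul _ _
        _ ≤ |l| * (M + |m|) := by
            gcongr
            exact (abs_sub _ _).trans (by gcongr; exact hM x)
    · intro l
      refine (integral_exp_sub_integral_pi_le P hc0 l n f hf M hM hc).trans (le_of_eq ?_)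
      change _ = Real.exp (n * c ^ 2 / 4 * l ^ 2 / 2)
      congr 1
      ring
  have h := hsub.measure_ge_le ht
  have hset : {x | m + t ≤ f x} = {x | t ≤ f x - m} := by
    ext x; simp only [Set.mem_ofPred_eq]; constructor <;> intro h <;> linarith
  rw [hset]
  refine h.trans (le_of_eq ?_)
  change Real.exp (-t ^ 2 / (2 * (n * c ^ 2 / 4))) = _
  congr 1
  rw [neg_div, show 2 * (n * c ^ 2 / 4) = n * c ^ 2 / 2 by ring, div_div_eq_mul_div]
  ring_nf

end BoundedDifferences

/-! ### Uniform deviation of empirical counts over a VC class. -/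

section UniformDeviation

variable {X : Type*} {ι : Type*} {n : ℕ}

/-- The number of sample points in `A`, as a real number. -/
noncomputable def hits (A : Set X) (x : Fin n → X) : ℝ :=
  ∑ i, A.indicator (fun _ => (1 : ℝ)) (x i)

/-- The maximal Rademacher sum over the traces of the sets `A j` on the sample. -/
noncomputable def maxRademacher (A : ι → Set X) (s : Fin n → Bool) (x : Fin n → X) : ℝ :=
  ⨆ j, |radSum s fun i => (A j).indicator (fun _ => (1 : ℝ)) (x i)|

/-- Every finite sequence shattered by the class `A` has length at most `V`. -/
def ShatterBound (A : ι → Set X) (V : ℕ) : Prop :=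
  ∀ (m : ℕ) (x : Fin m → X) (T : Finset (Fin m)),
    (∀ t ⊆ T, ∃ j, ∀ i ∈ T, (i ∈ t ↔ x i ∈ A j)) → T.card ≤ V

lemma indicator_one_nonneg (A : Set X) (x : X) : 0 ≤ A.indicator (fun _ => (1 : ℝ)) x :=
  Set.indicator_nonneg (fun _ _ => zero_le_one) x

lemma indicator_one_le (A : Set X) (x : X) : A.indicator (fun _ => (1 : ℝ)) x ≤ 1 :=
  Set.indicator_le' (fun _ _ => le_rfl) (fun _ _ => zero_le_one) x

lemma hits_nonneg (A : Set X) (x : Fin n → X) : 0 ≤ hits A x :=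
  Finset.sum_nonneg fun _ _ => indicator_one_nonneg _ _

lemma hits_le (A : Set X) (x : Fin n → X) : hits A x ≤ n := by
  calc hits A x ≤ ∑ _i : Fin n, (1 : ℝ) := Finset.sum_le_sum fun _ _ => indicator_one_le _ _
    _ = n := by simp

lemma abs_hits_sub_le (A : Set X) (x : Fin n → X) {p : ℝ} (hp0 : 0 ≤ p) (hp1 : p ≤ 1) :
    |hits A x - n * p| ≤ n := by
  have h1 := hits_nonneg A x
  have h2 := hits_le A x
  have h3 : (0 : ℝ) ≤ n := n.cast_nonneg
  rw [abs_le]; constructor <;> nlinarith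

lemma abs_radSum_indicator_le (A : Set X) (s : Fin n → Bool) (x : Fin n → X) :
    |radSum s fun i => A.indicator (fun _ => (1 : ℝ)) (x i)| ≤ n := by
  refine (Finset.abs_sum_le_sum_abs _ _).trans ?_
  calc ∑ i, |boolSign (s i) * A.indicator (fun _ => (1 : ℝ)) (x i)| ≤ ∑ _i : Fin n, (1 : ℝ) := by
        refine Finset.sum_le_sum fun i _ => ?_
        have h1 : |boolSign (s i)| = 1 := by unfold boolSign; split_ifs <;> simp
        rw [abs_mul, h1, one_mul, abs_of_nonneg (indicator_one_nonneg _ _)]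
        exact indicator_one_le _ _
    _ = n := by simp

/-- A real `⨆` over an unbounded family is 0 by default, so `le_ciSup` needs this bound. -/
lemma bddAbove_radSum (A : ι → Set X) (s : Fin n → Bool) (x : Fin n → X) :
    BddAbove (Set.range fun j => |radSum s fun i => (A j).indicator (fun _ => (1 : ℝ)) (x i)|) :=
  ⟨n, by rintro _ ⟨j, rfl⟩; exact abs_radSum_indicator_le _ _ _⟩

lemma abs_maxRademacher_le [Nonempty ι] (A : ι → Set X) (s : Fin n → Bool) (x : Fin n → X) :
    |maxRademacher A s x| ≤ n := by
  obtain ⟨j⟩ := ‹Nonempty ι›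
  have h0 : 0 ≤ maxRademacher A s x :=
    (abs_nonneg _).trans (le_ciSup (bddAbove_radSum A s x) j)
  rw [abs_of_nonneg h0]
  exact ciSup_le fun j => abs_radSum_indicator_le _ _ _

/-- The combinatorial chaining bound, for the traces of a class of sets on a sample. -/
lemma signAvg_maxRademacher_le [Nonempty ι] {A : ι → Set X} {V : ℕ} (hV1 : 1 ≤ V)
    (hV : ShatterBound A V) (hn : 0 < n) (x : Fin n → X) :
    signAvg (fun s => maxRademacher A s x) ≤ 16 * √(n * V) := by
  classical
  set 𝒜 : Finset (Finset (Fin n)) :=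
    Finset.univ.filter fun S => ∃ j, ∀ i, (i ∈ S ↔ x i ∈ A j) with h𝒜
  have hmem : ∀ j, (Finset.univ.filter fun i => x i ∈ A j) ∈ 𝒜 := fun j =>
    Finset.mem_filter.2 ⟨Finset.mem_univ _, j, fun i => by simp⟩
  have hne : 𝒜.Nonempty := by
    obtain ⟨j⟩ := ‹Nonempty ι›
    exact ⟨_, hmem j⟩
  have hsh : ∀ T, 𝒜.Shatters T → T.card ≤ V := by
    intro T hT
    refine hV n x T fun t ht => ?_
    obtain ⟨u, hu, hut⟩ := hT ht
    obtain ⟨-, j, hj⟩ := Finset.mem_filter.1 hu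
    refine ⟨j, fun i hi => ?_⟩
    rw [← hut, Finset.mem_inter, ← hj i]
    exact and_iff_right hi
  have h := signAvg_sup_abs_radSum_finInd_le hV1 hsh (by simpa using hn) hne
  rw [Fintype.card_fin] at h
  refine (signAvg_mono fun s => ciSup_le fun j => ?_).trans h
  have h1 := Finset.le_sup' (fun S => |radSum s (finInd S)|) (hmem j)
  refine le_trans (le_of_eq ?_) h1
  congr 2
  funext i
  simp [finInd, Set.indicator_apply]

/-- Exchanging `x i` and `y i` for those `i` with `s i = false`. -/
def signSwap (s : Fin n → Bool) (p : (Fin n → X) × (Fin n → X)) : (Fin n → X) × (Fin n → X) :=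
  (fun i => if s i then p.1 i else p.2 i, fun i => if s i then p.2 i else p.1 i)

variable [MeasurableSpace X]

/-- The uniform deviation `sup_j |#{i | x i ∈ A j} - n P(A j)|`. -/
noncomputable def maxDeviation (A : ι → Set X) (P : Measure X) (x : Fin n → X) : ℝ :=
  ⨆ j, |hits (A j) x - n * P.real (A j)|

lemma measurable_hits {A : Set X} (hA : MeasurableSet A) :
    Measurable (hits A : (Fin n → X) → ℝ) :=
  Finset.measurable_sum _ fun i _ =>
    (measurable_const.indicator hA).comp (measurable_pi_apply i)

lemma bddAbove_deviation (A : ι → Set X) (P : Measure X) [IsProbabilityMeasure P]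
    (x : Fin n → X) :
    BddAbove (Set.range fun j => |hits (A j) x - n * P.real (A j)|) :=
  ⟨n, by
    rintro _ ⟨j, rfl⟩
    exact abs_hits_sub_le _ _ measureReal_nonneg measureReal_le_one⟩

lemma abs_hits_sub_le_maxDeviation (A : ι → Set X) (P : Measure X) [IsProbabilityMeasure P]
    (x : Fin n → X) (j : ι) : |hits (A j) x - n * P.real (A j)| ≤ maxDeviation A P x :=
  le_ciSup (bddAbove_deviation A P x) j

lemma maxDeviation_nonneg [Nonempty ι] (A : ι → Set X) (P : Measure X) [IsProbabilityMeasure P]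
    (x : Fin n → X) : 0 ≤ maxDeviation A P x := by
  obtain ⟨j⟩ := ‹Nonempty ι›
  exact (abs_nonneg _).trans (abs_hits_sub_le_maxDeviation A P x j)

lemma abs_maxDeviation_le [Nonempty ι] (A : ι → Set X) (P : Measure X) [IsProbabilityMeasure P]
    (x : Fin n → X) : |maxDeviation A P x| ≤ n := by
  rw [abs_of_nonneg (maxDeviation_nonneg A P x)]
  exact ciSup_le fun j => abs_hits_sub_le _ _ measureReal_nonneg measureReal_le_one

lemma maxDeviation_update_sub_le [Nonempty ι] (A : ι → Set X) (P : Measure X)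
    [IsProbabilityMeasure P] (x : Fin n → X) (i : Fin n) (y : X) :
    maxDeviation A P (Function.update x i y) - maxDeviation A P x ≤ 1 := by
  rw [sub_le_iff_le_add]
  refine ciSup_le fun j => ?_
  have h := abs_hits_sub_le_maxDeviation A P x j
  have h1 : hits (A j) (Function.update x i y) - hits (A j) x
      = (A j).indicator (fun _ => (1 : ℝ)) y - (A j).indicator (fun _ => (1 : ℝ)) (x i) := by
    rw [hits, hits, ← Finset.sum_sub_distrib, Finset.sum_eq_single i]
    · simp
    · intro k _ hk
      simp [Function.update_of_ne hk]
    · simp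
  have h2 : |hits (A j) (Function.update x i y) - hits (A j) x| ≤ 1 := by
    rw [h1, abs_le]
    constructor <;> linarith [indicator_one_nonneg (A j) y, indicator_one_nonneg (A j) (x i),
      indicator_one_le (A j) y, indicator_one_le (A j) (x i)]
  have h3 : hits (A j) (Function.update x i y) - n * P.real (A j)
      = (hits (A j) (Function.update x i y) - hits (A j) x)
        + (hits (A j) x - n * P.real (A j)) := by ring
  rw [h3]
  exact (abs_add_le _ _).trans (add_le_add h2 h)

/-- Countability of the index set makes the supremum measurable; this is why half-spaces are later
replaced by a countable dense family. -/
lemma measurable_maxDeviation [Countable ι] {A : ι → Set X} (hA : ∀ j, MeasurableSet (A j))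
    (P : Measure X) : Measurable (maxDeviation A P : (Fin n → X) → ℝ) :=
  Measurable.iSup fun j => by
    have := ((measurable_hits (n := n) (hA j)).sub_const (n * P.real (A j))).norm
    exact this

lemma measurable_maxRademacher [Countable ι] {A : ι → Set X} (hA : ∀ j, MeasurableSet (A j))
    (s : Fin n → Bool) : Measurable (maxRademacher A s : (Fin n → X) → ℝ) :=
  Measurable.iSup fun j => by
    have : Measurable fun x : Fin n → X =>
        radSum s fun i => (A j).indicator (fun _ => (1 : ℝ)) (x i) :=
      Finset.measurable_sum _ fun i _ =>
        ((measurable_const.indicator (hA j)).comp (measurable_pi_apply i)).const_mul _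
    exact this.norm

/-- Two samples of size n are n independent pairs, and swapping the entries of a pair preserves P ⊗
P. -/
lemma measurePreserving_signSwap (P : Measure X) [IsProbabilityMeasure P] (s : Fin n → Bool) :
    MeasurePreserving (signSwap s)
      ((Measure.pi fun _ : Fin n => P).prod (Measure.pi fun _ : Fin n => P))
      ((Measure.pi fun _ : Fin n => P).prod (Measure.pi fun _ : Fin n => P)) := by
  have he := measurePreserving_arrowProdEquivProdArrow X X (Fin n) (fun _ => P) (fun _ => P)
  have hsw : ∀ i, MeasurePreserving (if s i then id else Prod.swap : X × X → X × X)
      (P.prod P) (P.prod P) := by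
    intro i
    split_ifs
    · exact MeasurePreserving.id _
    · exact Measure.measurePreserving_swap
  have hpi := measurePreserving_pi (fun _ : Fin n => P.prod P) (fun _ => P.prod P) hsw
  have h := (he.comp hpi).comp (he.symm _)
  convert h using 1
  funext p
  simp only [signSwap, Function.comp_apply, MeasurableEquiv.arrowProdEquivProdArrow,
    Equiv.arrowProdEquivProdArrow]
  ext i
  · by_cases hs : s i <;> simp [hs]
  · by_cases hs : s i <;> simp [hs]

/-- Symmetrization: the mean uniform deviation is at most twice the mean Rademacher average. -/
lemma integral_maxDeviation_le [Countable ι] [Nonempty ι] {A : ι → Set X}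
    (hA : ∀ j, MeasurableSet (A j)) (P : Measure X) [IsProbabilityMeasure P] (s : Fin n → Bool) :
    ∫ x, maxDeviation A P x ∂(Measure.pi fun _ : Fin n => P)
      ≤ 2 * ∫ x, maxRademacher A s x ∂(Measure.pi fun _ : Fin n => P) := by
  set Q := Measure.pi fun _ : Fin n => P with hQ
  set G : (Fin n → X) × (Fin n → X) → ℝ := fun p => ⨆ j, |hits (A j) p.1 - hits (A j) p.2| with hG
  have hGle : ∀ (p : (Fin n → X) × (Fin n → X)) (j : ι), |hits (A j) p.1 - hits (A j) p.2| ≤ n := by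
    intro p j
    rw [abs_le]
    constructor <;> linarith [hits_nonneg (A j) p.1, hits_nonneg (A j) p.2, hits_le (A j) p.1,
      hits_le (A j) p.2]
  have hGbdd : ∀ p : (Fin n → X) × (Fin n → X),
      BddAbove (Set.range fun j => |hits (A j) p.1 - hits (A j) p.2|) := fun p =>
    ⟨n, by rintro _ ⟨j, rfl⟩; exact hGle p j⟩
  have hGm : Measurable G := Measurable.iSup fun j => by
    have := (((measurable_hits (n := n) (hA j)).comp measurable_fst).sub
      ((measurable_hits (n := n) (hA j)).comp measurable_snd)).norm
    exact this
  have hG0 : ∀ p, |G p| ≤ n := by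
    intro p
    obtain ⟨j⟩ := ‹Nonempty ι›
    have h0 : 0 ≤ G p := (abs_nonneg _).trans (le_ciSup (hGbdd p) j)
    rw [abs_of_nonneg h0]
    exact ciSup_le fun j => hGle p j
  have hGint : Integrable G (Q.prod Q) := integrable_of_measurable_of_abs_le hGm hG0
  have hhint : ∀ j, Integrable (hits (A j) : (Fin n → X) → ℝ) Q := fun j =>
    integrable_of_measurable_of_abs_le (measurable_hits (hA j)) fun x => by
      rw [abs_of_nonneg (hits_nonneg _ _)]; exact hits_le _ _
  have hmean : ∀ j, ∫ y, hits (A j) y ∂Q = n * P.real (A j) := by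
    intro j
    simp only [hits]
    rw [integral_finsetSum]
    · have : ∀ i : Fin n, ∫ y : Fin n → X, (A j).indicator (fun _ => (1 : ℝ)) (y i) ∂Q
          = P.real (A j) := by
        intro i
        have hmp := measurePreserving_eval (fun _ : Fin n => P) i
        have hm : AEStronglyMeasurable ((A j).indicator fun _ => (1 : ℝ))
            (Measure.map (Function.eval i) Q) :=
          (measurable_const.indicator (hA j)).aestronglyMeasurable
        refine (integral_map hmp.measurable.aemeasurable hm).symm.trans ?_
        rw [hmp.map_eq, integral_indicator (hA j)]
        simp
      simp [this]
    · intro i _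
      exact integrable_of_measurable_of_abs_le (M := 1)
        ((measurable_const.indicator (hA j)).comp (measurable_pi_apply i)) fun x => by
          rw [abs_of_nonneg (indicator_one_nonneg _ _)]; exact indicator_one_le _ _
  -- The centring n P(A j) is the mean count of an independent ghost sample y; the supremum then
  -- moves inside the integral over y.
  have h1 : ∀ x, maxDeviation A P x ≤ ∫ y, G (x, y) ∂Q := by
    intro x
    refine ciSup_le fun j => ?_
    rw [← hmean j]
    have : hits (A j) x - ∫ y, hits (A j) y ∂Q = ∫ y, (hits (A j) x - hits (A j) y) ∂Q := by
      rw [integral_sub (integrable_const _) (hhint j)]; simp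
    rw [this]
    refine (abs_integral_le_integral_abs).trans (integral_mono ?_ ?_ fun y => ?_)
    · exact ((integrable_const _).sub (hhint j)).abs
    · exact integrable_of_measurable_of_abs_le (hGm.comp measurable_prodMk_left) fun y => hG0 _
    · exact le_ciSup (hGbdd (x, y)) j
  -- Swapping the i-th pair flips the sign of the i-th difference, so the fixed signs s appear;
  -- averaging over s comes only afterwards.
  have hswap : ∀ p, G (signSwap s p) ≤ maxRademacher A s p.1 + maxRademacher A s p.2 := by
    intro p
    refine ciSup_le fun j => ?_
    have he : hits (A j) (signSwap s p).1 - hits (A j) (signSwap s p).2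
        = (radSum s fun i => (A j).indicator (fun _ => (1 : ℝ)) (p.1 i))
          - radSum s fun i => (A j).indicator (fun _ => (1 : ℝ)) (p.2 i) := by
      simp only [hits, radSum, signSwap, ← Finset.sum_sub_distrib]
      refine Finset.sum_congr rfl fun i _ => ?_
      by_cases hs : s i <;> simp [hs, boolSign]
      ring
    rw [he]
    exact (abs_sub _ _).trans
      (add_le_add (le_ciSup (bddAbove_radSum A s p.1) j) (le_ciSup (bddAbove_radSum A s p.2) j))
  have hRint : Integrable (maxRademacher A s) Q :=
    integrable_of_measurable_of_abs_le (measurable_maxRademacher hA s)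
      (abs_maxRademacher_le A s)
  have hmp := measurePreserving_signSwap (n := n) P s
  calc ∫ x, maxDeviation A P x ∂Q ≤ ∫ x, ∫ y, G (x, y) ∂Q ∂Q := by
        refine integral_mono ?_ hGint.integral_prod_left h1
        exact integrable_of_measurable_of_abs_le (measurable_maxDeviation hA P)
          (abs_maxDeviation_le A P)
    _ = ∫ p, G p ∂(Q.prod Q) := (integral_prod _ hGint).symm
    _ = ∫ p, G (signSwap s p) ∂(Q.prod Q) := by
        conv_lhs => rw [← hmp.map_eq]
        exact integral_map hmp.measurable.aemeasurable hGm.aestronglyMeasurable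
    _ ≤ ∫ p, (maxRademacher A s p.1 + maxRademacher A s p.2) ∂(Q.prod Q) :=
        integral_mono (integrable_of_measurable_of_abs_le (hGm.comp hmp.measurable)
          fun p => hG0 _) ((hRint.comp_fst Q).add (hRint.comp_snd Q)) hswap
    _ = 2 * ∫ x, maxRademacher A s x ∂Q := by
        rw [integral_add (hRint.comp_fst Q) (hRint.comp_snd Q), integral_fun_fst,
          integral_fun_snd]
        simp; ring

/-- The mean uniform deviation over a class of VC dimension at most `V`. -/
lemma integral_maxDeviation_le_sqrt [Countable ι] [Nonempty ι] {A : ι → Set X}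
    (hA : ∀ j, MeasurableSet (A j)) {V : ℕ} (hV1 : 1 ≤ V) (hV : ShatterBound A V)
    (P : Measure X) [IsProbabilityMeasure P] (hn : 0 < n) :
    ∫ x, maxDeviation A P x ∂(Measure.pi fun _ : Fin n => P) ≤ 32 * √(n * V) := by
  set Q := Measure.pi fun _ : Fin n => P
  have hRint : ∀ s : Fin n → Bool, Integrable (maxRademacher A s) Q := fun s =>
    integrable_of_measurable_of_abs_le (measurable_maxRademacher hA s)
      (abs_maxRademacher_le A s)
  calc ∫ x, maxDeviation A P x ∂Q
      -- The left side does not depend on s, so it may be averaged; the chaining bound then holds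
      -- for every sample x.
      = signAvg fun _ : Fin n → Bool => ∫ x, maxDeviation A P x ∂Q := (signAvg_const _).symm
    _ ≤ signAvg fun s => 2 * ∫ x, maxRademacher A s x ∂Q :=
        signAvg_mono fun s => integral_maxDeviation_le hA P s
    _ = 2 * ∫ x, signAvg (fun s => maxRademacher A s x) ∂Q := by
        rw [signAvg_mul]
        simp only [signAvg]
        rw [integral_finsetSum _ fun s _ => (hRint s).const_mul _]
        simp_rw [integral_const_mul]
    _ ≤ 2 * ∫ x, 16 * √(n * V) ∂Q := by
        gcongr
        · exact integrable_finsetSum _ fun s _ => (hRint s).const_mul _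
        · exact integrable_const _
        · exact fun x => signAvg_maxRademacher_le hV1 hV hn x
    _ = 32 * √(n * V) := by simp; ring

/-- Concentration of the uniform deviation over a class of VC dimension at most `V`. -/
theorem measureReal_pi_maxDeviation_ge_le [Countable ι] [Nonempty ι] {A : ι → Set X}
    (hA : ∀ j, MeasurableSet (A j)) {V : ℕ} (hV1 : 1 ≤ V) (hV : ShatterBound A V)
    (P : Measure X) [IsProbabilityMeasure P] (hn : 0 < n) {t : ℝ} (ht : 0 ≤ t) :
    (Measure.pi fun _ : Fin n => P).real {x | 32 * √(n * V) + t ≤ maxDeviation A P x}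
      ≤ Real.exp (-(2 * t ^ 2 / n)) := by
  have h := measureReal_pi_add_le_of_bounded_differences P (n := n) zero_le_one
    (measurable_maxDeviation hA P) (abs_maxDeviation_le A P)
    (maxDeviation_update_sub_le A P) ht
  rw [one_pow, mul_one] at h
  refine le_trans (measureReal_mono fun x hx => ?_) h
  simp only [Set.mem_ofPred_eq] at hx ⊢
  linarith [integral_maxDeviation_le_sqrt hA hV1 hV P hn]

end UniformDeviation

/-! ### From uniformly close tails to close r-th moments. -/

section MomentComparison

lemma mul_rpow_inv_rpow {a b r : ℝ} (ha : 0 ≤ a) (hb : 0 ≤ b) (hr : r ≠ 0) :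
    (a ^ (1 / r) * b) ^ r = a * b ^ r := by
  rw [Real.mul_rpow (by positivity) hb, ← Real.rpow_mul ha, one_div_mul_cancel hr, Real.rpow_one]

/-- Minkowski's inequality for a variable which is `b + L` with probability `η` and `b` otherwise. -/
lemma two_point_minkowski {b L η r : ℝ} (hb : 0 ≤ b) (hL : 0 ≤ L) (hη0 : 0 ≤ η) (hη1 : η ≤ 1)
    (hr : 1 ≤ r) :
    (1 - η) * b ^ r + η * (b + L) ^ r ≤ (b + L * η ^ (1 / r)) ^ r := by
  have hr0 : r ≠ 0 := by positivity
  have hη' : 0 ≤ 1 - η := by linarith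
  -- The factors (1 - η)^(1/r) and η^(1/r) encode the two probabilities in an unweighted ℓ^r norm.
  have h := Real.Lp_add_le Finset.univ ![(1 - η) ^ (1 / r) * b, η ^ (1 / r) * b]
    ![0, η ^ (1 / r) * L] hr
  simp only [Fin.sum_univ_two, Matrix.cons_val_zero, Matrix.cons_val_one, add_zero, abs_zero,
    Real.zero_rpow hr0, zero_add] at h
  rw [← mul_add, abs_of_nonneg (by positivity), abs_of_nonneg (by positivity),
    abs_of_nonneg (by positivity), abs_of_nonneg (by positivity), mul_rpow_inv_rpow hη' hb hr0,
    mul_rpow_inv_rpow hη0 hb hr0, mul_rpow_inv_rpow hη0 (by positivity) hr0,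
    mul_rpow_inv_rpow hη0 hL hr0, ← add_mul, sub_add_cancel, one_mul, ← Real.rpow_mul hb,
    mul_one_div_cancel hr0, Real.rpow_one, Real.mul_rpow hη0 (by positivity), ← Real.rpow_mul hL,
    mul_one_div_cancel hr0, Real.rpow_one] at h
  have h2 := Real.rpow_le_rpow (by positivity) h (show 0 ≤ r by linarith)
  rw [← Real.rpow_mul (by positivity), one_div_mul_cancel hr0, Real.rpow_one] at h2
  rwa [mul_comm L]

/-- The increments of `x ^ r` over intervals of a given length increase. -/
lemma rpow_add_sub_rpow_mono {m b L r : ℝ} (hm : 0 ≤ m) (hmb : m ≤ b) (hL : 0 ≤ L) (hr : 1 ≤ r) :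
    (m + L) ^ r - m ^ r ≤ (b + L) ^ r - b ^ r := by
  rcases hL.eq_or_lt with rfl | hL
  · simp
  have hc := convexOn_rpow hr
  have hD : 0 < b - m + L := by linarith
  -- m + L and b are the convex combinations of m and b + L with weights w and 1 - w interchanged;
  -- the two convexity inequalities add up to the claim.
  set w := L / (b - m + L) with hw
  have hw0 : 0 ≤ w := by positivity
  have hw1 : 0 ≤ 1 - w := by
    rw [sub_nonneg, hw, div_le_one hD]; linarith
  have hwD : w * (b - m + L) = L := by rw [hw]; field_simp
  have h1 := hc.2 (Set.mem_Ici.2 hm) (Set.mem_Ici.2 (show 0 ≤ b + L by linarith)) hw1 hw0 (by ring)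
  have h2 := hc.2 (Set.mem_Ici.2 hm) (Set.mem_Ici.2 (show 0 ≤ b + L by linarith)) hw0 hw1 (by ring)
  simp only [smul_eq_mul] at h1 h2
  rw [show (1 - w) * m + w * (b + L) = m + L by linarith] at h1
  rw [show w * m + (1 - w) * (b + L) = b by linarith] at h2
  linarith

/-- With b = B^(1/r) ≥ m the increment over [m, m + L] is at most that over [b, b + L], so A is at
most the r-th moment of the two-point variable of `two_point_minkowski`. The error depends on L but
not on the size of m or B. -/
lemma rpow_inv_le_add_of_le_add {A B m L η r : ℝ} (hA : 0 ≤ A) (hm : 0 ≤ m) (hL : 0 ≤ L)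
    (hη0 : 0 ≤ η) (hη1 : η ≤ 1) (hr : 1 ≤ r) (hB : m ^ r ≤ B)
    (hAB : A ≤ B + η * ((m + L) ^ r - m ^ r)) :
    A ^ (1 / r) ≤ B ^ (1 / r) + L * η ^ (1 / r) := by
  have hr0 : r ≠ 0 := by positivity
  have hrp : 0 < r := by linarith
  have hB0 : 0 ≤ B := (Real.rpow_nonneg hm r).trans hB
  set b := B ^ (1 / r) with hb
  have hb0 : 0 ≤ b := Real.rpow_nonneg hB0 _
  have hbr : b ^ r = B := by rw [hb, ← Real.rpow_mul hB0, one_div_mul_cancel hr0, Real.rpow_one]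
  have hmb : m ≤ b := by
    rw [← Real.rpow_le_rpow_iff hm hb0 hrp, hbr]; exact hB
  have h1 := two_point_minkowski hb0 hL hη0 hη1 hr
  have h2 := mul_le_mul_of_nonneg_left (rpow_add_sub_rpow_mono hm hmb hL hr) hη0
  have h3 : A ≤ (b + L * η ^ (1 / r)) ^ r := by
    rw [hbr] at h1 h2
    linarith
  have h4 := Real.rpow_le_rpow hA h3 (show 0 ≤ 1 / r by positivity)
  rwa [← Real.rpow_mul (by positivity), mul_one_div_cancel hr0, Real.rpow_one] at h4

variable {Y : Type*} [MeasurableSpace Y]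

/-- The closed two-sided tail is expressed through complements of strict one-sided events, which are
open half-spaces for residuals. The two sides cause the factor 2 in 2ε; they are disjoint because u
> 0. -/
lemma measureReal_le_abs {μ : Measure Y} [IsProbabilityMeasure μ] {x : Y → ℝ}
    (hx : Measurable x) {u : ℝ} (hu : 0 < u) :
    μ.real {y | u ≤ |x y|} = 2 - μ.real {y | -u < x y} - μ.real {y | -u < - x y} := by
  have hset : {y | u ≤ |x y|} = {y | -u < x y}ᶜ ∪ {y | -u < - x y}ᶜ := by
    ext y
    simp only [Set.mem_ofPred_eq, Set.mem_union, Set.mem_compl_iff, not_lt, le_abs]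
    constructor
    · rintro (h | h)
      · right; linarith
      · left; linarith
    · rintro (h | h)
      · right; linarith
      · left; linarith
  have hdisj : Disjoint {y | -u < x y}ᶜ {y | -u < - x y}ᶜ := by
    rw [Set.disjoint_left]
    intro y h1 h2
    simp only [Set.mem_compl_iff, Set.mem_ofPred_eq, not_lt] at h1 h2
    linarith
  have hm1 : MeasurableSet {y | -u < x y} := measurableSet_lt measurable_const hx
  have hm2 : MeasurableSet {y | -u < - x y} := measurableSet_lt measurable_const hx.neg
  rw [hset, measureReal_union hdisj hm2.compl, probReal_compl_eq_one_sub hm1,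
    probReal_compl_eq_one_sub hm2]
  ring

/-- Comparison of the `r`-th absolute moments of a variable under two distributions whose
distribution functions are uniformly close. -/
lemma abs_moment_le_add_of_discrepancy {μ ν : Measure Y} [IsProbabilityMeasure μ]
    [IsProbabilityMeasure ν] {x : Y → ℝ} (hx : Measurable x) {m L ε r : ℝ} (hm : 0 ≤ m)
    (hL : 0 ≤ L) (hε : 0 ≤ ε) (hr : 1 ≤ r)
    (hμ : ∀ᵐ y ∂μ, m ≤ |x y| ∧ |x y| ≤ m + L) (hν : ∀ᵐ y ∂ν, m ≤ |x y| ∧ |x y| ≤ m + L)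
    (h1 : ∀ t, |μ.real {y | t < x y} - ν.real {y | t < x y}| ≤ ε)
    (h2 : ∀ t, |μ.real {y | t < - x y} - ν.real {y | t < - x y}| ≤ ε) :
    (∫ y, |x y| ^ r ∂μ) ^ (1 / r) ≤ (∫ y, |x y| ^ r ∂ν) ^ (1 / r) + L * (2 * ε) ^ (1 / r) := by
  have hr0 : 0 < r := by linarith
  set c := (m + L) ^ r - m ^ r with hc
  have hc0 : 0 ≤ c := sub_nonneg.2 (Real.rpow_le_rpow hm (by linarith) hr0.le)
  -- Capped at 1 because it serves as a probability in the two-point comparison.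
  set η := min (2 * ε) 1 with hη
  have hη0 : 0 ≤ η := le_min (by linarith) zero_le_one
  -- Subtracting m^r confines the layer-cake integral to levels in (0, c], so a tail discrepancy η
  -- costs only η c.
  set h : Y → ℝ := fun y => |x y| ^ r - m ^ r with hh
  have hhm : Measurable h := (hx.norm.pow_const r).sub_const _
  have hb : ∀ (κ : Measure Y) [IsProbabilityMeasure κ],
      (∀ᵐ y ∂κ, m ≤ |x y| ∧ |x y| ≤ m + L) →
      Integrable h κ ∧ (0 ≤ᵐ[κ] h) ∧ (h ≤ᵐ[κ] fun _ => c) := by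
    intro κ _ hκ
    have h0 : 0 ≤ᵐ[κ] h := by
      filter_upwards [hκ] with y hy
      exact sub_nonneg.2 (Real.rpow_le_rpow hm hy.1 hr0.le)
    have h1 : h ≤ᵐ[κ] fun _ => c := by
      filter_upwards [hκ] with y hy
      exact sub_le_sub_right (Real.rpow_le_rpow (abs_nonneg _) hy.2 hr0.le) _
    refine ⟨Integrable.of_bound hhm.aestronglyMeasurable c ?_, h0, h1⟩
    filter_upwards [h0, h1] with y hy0 hy1
    rw [Real.norm_of_nonneg hy0]
    exact hy1
  obtain ⟨hμi, hμ0, hμc⟩ := hb μ hμ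
  obtain ⟨hνi, hν0, hνc⟩ := hb ν hν
  have hmom : ∀ (κ : Measure Y) [IsProbabilityMeasure κ], Integrable h κ →
      ∫ y, |x y| ^ r ∂κ = ∫ y, h y ∂κ + m ^ r := by
    intro κ _ hκ
    have : ∀ y, |x y| ^ r = h y + m ^ r := fun y => by simp [hh]
    simp_rw [this]
    rw [integral_add hκ (integrable_const _)]
    simp
  have htail : ∀ t ∈ Set.Ioc 0 c, μ.real {y | t ≤ h y} ≤ ν.real {y | t ≤ h y} + η := by
    intro t ht
    have hu : 0 < (t + m ^ r) ^ (1 / r) := by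
      have := Real.rpow_nonneg hm r
      have := ht.1
      positivity
    have hset : {y | t ≤ h y} = {y | (t + m ^ r) ^ (1 / r) ≤ |x y|} := by
      ext y
      simp only [Set.mem_ofPred_eq, hh]
      have h0 : 0 ≤ t + m ^ r := add_nonneg ht.1.le (Real.rpow_nonneg hm r)
      rw [one_div, Real.rpow_inv_le_iff_of_pos h0 (abs_nonneg _) hr0]
      constructor <;> intro h <;> linarith
    rw [hset, measureReal_le_abs hx hu, measureReal_le_abs hx hu, ← sub_le_iff_le_add']
    refine le_min ?_ ?_
    · have e1 := abs_le.1 (h1 (-(t + m ^ r) ^ (1 / r)))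
      have e2 := abs_le.1 (h2 (-(t + m ^ r) ^ (1 / r)))
      linarith [e1.1, e2.1]
    · rw [← measureReal_le_abs hx hu, ← measureReal_le_abs hx hu]
      linarith [measureReal_le_one (μ := μ) (s := {y | (t + m ^ r) ^ (1 / r) ≤ |x y|}),
        measureReal_nonneg (μ := ν) (s := {y | (t + m ^ r) ^ (1 / r) ≤ |x y|})]
  have hanti : ∀ (κ : Measure Y) [IsProbabilityMeasure κ],
      IntegrableOn (fun t => κ.real {y | t ≤ h y}) (Set.Ioc 0 c) := by
    intro κ _
    have ha : Antitone fun t => κ.real {y | t ≤ h y} := fun s t hst =>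
      measureReal_mono fun y (hy : t ≤ h y) => hst.trans hy
    exact Measure.integrableOn_of_bounded (M := 1) (by simp) ha.measurable.aestronglyMeasurable
      (Filter.Eventually.of_forall fun t => by
        rw [Real.norm_of_nonneg measureReal_nonneg]; exact measureReal_le_one)
  have hint : ∫ y, h y ∂μ ≤ ∫ y, h y ∂ν + η * c := by
    rw [hμi.integral_eq_integral_Ioc_meas_le hμ0 hμc, hνi.integral_eq_integral_Ioc_meas_le hν0 hνc]
    have hconst : ∫ _t in Set.Ioc 0 c, η = η * c := by
      simp [hc0, mul_comm]
    rw [← hconst, ← integral_add (hanti ν) (by simp)]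
    exact setIntegral_mono_on (hanti μ) ((hanti ν).add (by simp)) measurableSet_Ioc htail
  have hfin := rpow_inv_le_add_of_le_add (A := ∫ y, |x y| ^ r ∂μ) (B := ∫ y, |x y| ^ r ∂ν)
    (integral_nonneg fun y => by positivity) hm hL hη0 (min_le_right _ _) hr
    (by rw [hmom ν hνi]; linarith [integral_nonneg_of_ae hν0])
    (by rw [hmom ν hνi, hmom μ hμi]; linarith)
  refine hfin.trans ?_
  gcongr
  exact min_le_left _ _

end MomentComparison

/-! ### Half-spaces: VC dimension and a countable dense family. -/

section Halfspaces

open Filter Topology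

variable {d : ℕ}

/-- The open half-space `{(x, y) | t < xᵀ a + b y}` with parameters `p = (a, b, t)`. -/
def openHalfspace (p : Cov d × ℝ × ℝ) : Set (Obs d) :=
  {z | p.2.2 < inner ℝ z.1 p.1 + p.2.1 * z.2}

lemma mem_openHalfspace {p : Cov d × ℝ × ℝ} {z : Obs d} :
    z ∈ openHalfspace p ↔ p.2.2 < inner ℝ z.1 p.1 + p.2.1 * z.2 := Iff.rfl

lemma measurableSet_openHalfspace (p : Cov d × ℝ × ℝ) : MeasurableSet (openHalfspace p) :=
  measurableSet_lt measurable_const (by fun_prop)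

/-- Half-spaces in `ℝ^(d+1)` shatter no more than `d + 2` points. -/
lemma shatterBound_openHalfspace {ι : Type*} (p : ι → Cov d × ℝ × ℝ) :
    ShatterBound (fun j => openHalfspace (p j)) (d + 2) := by
  intro m x T hT
  by_contra! hcard
  -- The vectors (x, y, 1) lie in dimension d + 2, so d + 3 of them satisfy an affine relation.
  let v : T → Cov d × ℝ × ℝ := fun i => ((x i).1, (x i).2, 1)
  have hdep : ¬ LinearIndependent ℝ v := by
    intro hli
    have h := hli.fintype_card_le_finrank
    simp at h
    omega
  obtain ⟨g₀, hg₀, i₀, hi₀⟩ := Fintype.not_linearIndependent_iff.1 hdep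
  -- A positive coefficient is needed: the half-space is open, so points outside it only give φ ≤ 0,
  -- and strict positivity must come from a selected point.
  obtain ⟨g, hg, i₁, hi₁⟩ : ∃ g : T → ℝ, ∑ i, g i • v i = 0 ∧ ∃ i, 0 < g i := by
    rcases lt_or_gt_of_ne hi₀ with h | h
    · exact ⟨fun i => - g₀ i, by simp only [neg_smul, Finset.sum_neg_distrib, hg₀, neg_zero], i₀, by simpa using h⟩
    · exact ⟨g₀, hg₀, i₀, h⟩
  -- A half-space that picks exactly the points with positive coefficient makes every term g i * φ
  -- (v i) nonnegative and one positive, although they sum to 0.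
  obtain ⟨j, hj⟩ := hT (T.filter fun i => ∃ h : i ∈ T, 0 < g ⟨i, h⟩) (Finset.filter_subset _ _)
  let φ : Cov d × ℝ × ℝ → ℝ := fun w =>
    inner ℝ w.1 (p j).1 + (p j).2.1 * w.2.1 - (p j).2.2 * w.2.2
  have hφsum : ∑ i, g i * φ (v i) = 0 := by
    have h1 : ∑ i, g i • (x i).1 = 0 := by simpa [v, Prod.fst_sum] using congrArg Prod.fst hg
    have h2 : ∑ i, g i * (x i).2 = 0 := by
      simpa [v, Prod.fst_sum, Prod.snd_sum] using congrArg (fun w => w.2.1) hg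
    have h3 : ∑ i, g i = 0 := by
      simpa [v, Prod.fst_sum, Prod.snd_sum] using congrArg (fun w => w.2.2) hg
    have h4 : ∑ i, g i * inner ℝ (x i).1 (p j).1 = 0 := by
      have := congrArg (fun w => inner ℝ w (p j).1) h1
      simpa [sum_inner, real_inner_smul_left] using this
    calc ∑ i, g i * φ (v i) = ∑ i, g i * inner ℝ (x i).1 (p j).1
          + (p j).2.1 * ∑ i, g i * (x i).2 - (p j).2.2 * ∑ i, g i := by
          rw [Finset.mul_sum, Finset.mul_sum, ← Finset.sum_add_distrib, ← Finset.sum_sub_distrib]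
          exact Finset.sum_congr rfl fun i _ => by simp only [φ, v]; ring
      _ = 0 := by rw [h2, h3, h4]; ring
  have hiff : ∀ i : T, 0 < g i ↔ 0 < φ (v i) := by
    intro i
    have h := hj i i.2
    rw [Finset.mem_filter, mem_openHalfspace] at h
    simp only [φ, v, mul_one, sub_pos]
    rw [← h]
    simp
  have hterm : ∀ i : T, 0 ≤ g i * φ (v i) := by
    intro i
    by_cases hi : 0 < g i
    · exact (mul_pos hi ((hiff i).1 hi)).le
    · exact mul_nonneg_of_nonpos_of_nonpos (not_lt.1 hi)
        (not_lt.1 fun h => hi ((hiff i).2 h))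
  have hpos : 0 < ∑ i, g i * φ (v i) :=
    Finset.sum_pos' (fun i _ => hterm i) ⟨i₁, Finset.mem_univ _, mul_pos hi₁ ((hiff i₁).1 hi₁)⟩
  exact hpos.ne' hφsum

/-- On a bounded set every half-space is a pointwise limit of half-spaces from a countable dense
family. -/
lemma exists_seq_openHalfspace (p : Cov d × ℝ × ℝ) {R : ℝ} (hR : 0 ≤ R) :
    ∃ u : ℕ → ℕ, ∀ z : Obs d, ‖z‖ ≤ R → ∀ᶠ k in atTop,
      (z ∈ openHalfspace (TopologicalSpace.denseSeq (Cov d × ℝ × ℝ) (u k)) ↔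
        z ∈ openHalfspace p) := by
  -- The threshold is raised by 1/(k+1) and the total perturbation on the ball, at most (2R + 1)
  -- times the parameter distance, is smaller than that. Points outside, including the boundary,
  -- stay outside for every k; points inside are eventually inside.
  have hex : ∀ k : ℕ, ∃ j : ℕ, dist (p.1, p.2.1, p.2.2 + 1 / ((k : ℝ) + 1))
      (TopologicalSpace.denseSeq (Cov d × ℝ × ℝ) j) < 1 / ((k : ℝ) + 1) / (2 * R + 2) := by
    intro k
    obtain ⟨j, hj⟩ := (TopologicalSpace.denseRange_denseSeq
      (Cov d × ℝ × ℝ)).exists_dist_lt (p.1, p.2.1, p.2.2 + 1 / ((k : ℝ) + 1))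
      (show 0 < 1 / ((k : ℝ) + 1) / (2 * R + 2) by positivity)
    exact ⟨j, hj⟩
  choose u hu using hex
  refine ⟨u, fun z hz => ?_⟩
  set q : ℕ → Cov d × ℝ × ℝ := fun k => TopologicalSpace.denseSeq (Cov d × ℝ × ℝ) (u k) with hq
  set f := inner ℝ z.1 p.1 + p.2.1 * z.2 with hf
  have hkey : ∀ k : ℕ, |inner ℝ z.1 (q k).1 + (q k).2.1 * z.2 - f| < 1 / ((k : ℝ) + 1)
        - |(q k).2.2 - (p.2.2 + 1 / ((k : ℝ) + 1))| := by
    intro k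
    have hk := hu k
    rw [dist_comm, lt_div_iff₀ (by positivity), Prod.dist_eq, Prod.dist_eq] at hk
    change max (dist (q k).1 p.1) (max (dist (q k).2.1 p.2.1)
      (dist (q k).2.2 (p.2.2 + 1 / ((k : ℝ) + 1)))) * (2 * R + 2) < _ at hk
    set D := max (dist (q k).1 p.1) (max (dist (q k).2.1 p.2.1)
      (dist (q k).2.2 (p.2.2 + 1 / ((k : ℝ) + 1)))) with hD
    have d1 : ‖(q k).1 - p.1‖ ≤ D := by rw [← dist_eq_norm]; exact le_max_left _ _
    have d2 : |(q k).2.1 - p.2.1| ≤ D := by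
      rw [← Real.dist_eq]; exact (le_max_left _ _).trans (le_max_right _ _)
    have d3 : |(q k).2.2 - (p.2.2 + 1 / ((k : ℝ) + 1))| ≤ D := by
      rw [← Real.dist_eq]; exact (le_max_right _ _).trans (le_max_right _ _)
    have z1 : ‖z.1‖ ≤ R := (norm_fst_le z).trans hz
    have z2 : |z.2| ≤ R := (norm_snd_le z).trans hz
    have hD0 : 0 ≤ D := (norm_nonneg _).trans d1
    have e : inner ℝ z.1 (q k).1 + (q k).2.1 * z.2 - f
        = inner ℝ z.1 ((q k).1 - p.1) + ((q k).2.1 - p.2.1) * z.2 := by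
      rw [hf, inner_sub_right]; ring
    have b1 : |inner ℝ z.1 ((q k).1 - p.1)| ≤ R * D :=
      (abs_real_inner_le_norm _ _).trans (mul_le_mul z1 d1 (norm_nonneg _) hR)
    have b2 : |((q k).2.1 - p.2.1) * z.2| ≤ D * R := by
      rw [abs_mul]; exact mul_le_mul d2 z2 (abs_nonneg _) hD0
    rw [e]
    have := abs_add_le (inner ℝ z.1 ((q k).1 - p.1)) (((q k).2.1 - p.2.1) * z.2)
    nlinarith
  by_cases hmem : z ∈ openHalfspace p
  · have hlt : p.2.2 < f := hmem
    have hlim : ∀ᶠ k : ℕ in atTop, 1 / ((k : ℝ) + 1) < (f - p.2.2) / 2 :=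
      tendsto_one_div_add_atTop_nhds_zero_nat.eventually_lt_const (by linarith)
    filter_upwards [hlim] with k hk
    refine iff_of_true ?_ hmem
    rw [mem_openHalfspace]
    have h := hkey k
    change (q k).2.2 < inner ℝ z.1 (q k).1 + (q k).2.1 * z.2
    have h1 := neg_abs_le (inner ℝ z.1 (q k).1 + (q k).2.1 * z.2 - f)
    have h2 := le_abs_self ((q k).2.2 - (p.2.2 + 1 / ((k : ℝ) + 1)))
    linarith
  · have hle : f ≤ p.2.2 := not_lt.1 hmem
    refine Eventually.of_forall fun k => iff_of_false ?_ hmem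
    rw [mem_openHalfspace, not_lt]
    have h := hkey k
    change inner ℝ z.1 (q k).1 + (q k).2.1 * z.2 ≤ (q k).2.2
    have h1 := le_abs_self (inner ℝ z.1 (q k).1 + (q k).2.1 * z.2 - f)
    have h2 := neg_abs_le ((q k).2.2 - (p.2.2 + 1 / ((k : ℝ) + 1)))
    linarith

/-- The maximal deviation over a countable dense family of half-spaces bounds the deviation of
every half-space, if the distribution and the sample are concentrated on a bounded set. -/
lemma abs_hits_openHalfspace_sub_le {n : ℕ} (P : Measure (Obs d)) [IsProbabilityMeasure P] {R : ℝ}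
    (hR : 0 ≤ R) (hP : ∀ᵐ z ∂P, ‖z‖ ≤ R) {x : Fin n → Obs d} (hx : ∀ i, ‖x i‖ ≤ R)
    (p : Cov d × ℝ × ℝ) :
    |hits (openHalfspace p) x - n * P.real (openHalfspace p)|
      ≤ maxDeviation
        (fun j : ℕ => openHalfspace (TopologicalSpace.denseSeq (Cov d × ℝ × ℝ) j)) P x := by
  obtain ⟨u, hu⟩ := exists_seq_openHalfspace p hR
  set A : ℕ → Set (Obs d) :=
    fun j => openHalfspace (TopologicalSpace.denseSeq (Cov d × ℝ × ℝ) j) with hA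
  have hlimP : Tendsto (fun k => P.real (A (u k))) atTop (𝓝 (P.real (openHalfspace p))) := by
    refine (ENNReal.tendsto_toReal (measure_ne_top _ _)).comp ?_
    refine tendsto_measure_of_ae_tendsto_indicator_of_isFiniteMeasure _
      (measurableSet_openHalfspace p) (fun k => measurableSet_openHalfspace _) ?_
    filter_upwards [hP] with z hz using hu z hz
  have hlimx : Tendsto (fun k => hits (A (u k)) x) atTop (𝓝 (hits (openHalfspace p) x)) := by
    refine tendsto_finsetSum _ fun i _ => tendsto_const_nhds.congr' ?_
    filter_upwards [hu (x i) (hx i)] with k hk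
    by_cases h : x i ∈ openHalfspace p
    · rw [Set.indicator_of_mem h, Set.indicator_of_mem (hk.2 h)]
    · rw [Set.indicator_of_notMem h, Set.indicator_of_notMem fun h' => h (hk.1 h')]
  exact le_of_tendsto ((hlimx.sub (hlimP.const_mul _)).abs)
    (Eventually.of_forall fun k => abs_hits_sub_le_maxDeviation A P x (u k))

end Halfspaces

/-! ### Identities for the penalty and its admissible subgradients. -/

section Penalty

variable {d : ℕ} {ρ : Cov d → ℝ}

/-- Equality case of Fenchel–Young: the subgradient inequality says that the supremum is attained at
β. -/
lemma conjugate_eq_of_isSubgradient {β b : Cov d} (h : IsSubgradient ρ β b) :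
    conjugate ρ b = inner ℝ b β - ρ β := by
  have hle : ∀ x, inner ℝ b x - ρ x ≤ inner ℝ b β - ρ β := by
    intro x
    have := h x
    rw [inner_sub_right] at this
    linarith
  exact le_antisymm (ciSup_le hle)
    (le_ciSup (f := fun x => inner ℝ b x - ρ x) ⟨_, by rintro _ ⟨x, rfl⟩; exact hle x⟩ β)

/-- The correction along β subtracts exactly ρ^*(b) from bᵀβ. Moving X by -e times the loading thus
adds eρ(β) to the residual. -/
lemma inner_loading_of_ne_zero {β b : Cov d} (h : IsSubgradient ρ β b) (hβ : β ≠ 0) :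
    inner ℝ β (loading ρ β b) = ρ β := by
  have hne : inner ℝ β β ≠ 0 := inner_self_ne_zero.2 hβ
  rw [loading, inner_sub_right, real_inner_smul_right, div_mul_cancel₀ _ hne,
    conjugate_eq_of_isSubgradient h, real_inner_comm]
  ring

/-- Admissible subgradients force the penalty to vanish at the origin. -/
lemma penalty_zero [Nontrivial (Cov d)] (hρ0 : ∀ γ, 0 ≤ ρ γ) (hconv : ConvexOn ℝ Set.univ ρ)
    (hgood : ∀ β : Cov d, ∃ b : Cov d, IsGoodSubgradient ρ β b) : ρ 0 = 0 := by
  obtain ⟨u, hu⟩ := exists_ne (0 : Cov d)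
  -- Admissibility at t • w, tested against w, gives ρ(tw) = t wᵀv ≤ tρ(w). Hence ρ is small at
  -- small multiples of ±u, and convexity carries this to their midpoint 0.
  have hlin : ∀ w : Cov d, w ≠ 0 → ∀ t : ℝ, 0 < t → ρ (t • w) ≤ t * ρ w := by
    intro w hw t ht
    obtain ⟨b, hb, hb'⟩ := hgood (t • w)
    have h1 := inner_loading_of_ne_zero hb (smul_ne_zero ht.ne' hw)
    rw [real_inner_smul_left] at h1
    rw [← h1]
    gcongr
    exact (le_abs_self _).trans (hb' w)
  refine le_antisymm (le_of_forall_pos_le_add fun ε hε => ?_) (hρ0 0)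
  set s := ρ u + ρ (-u) + 1 with hs
  have hs0 : 0 < s := by linarith [hρ0 u, hρ0 (-u)]
  have hmid := hconv.2 (Set.mem_univ ((ε / s) • u)) (Set.mem_univ ((ε / s) • (-u)))
    (show (0 : ℝ) ≤ 1 / 2 by norm_num) (show (0 : ℝ) ≤ 1 / 2 by norm_num) (by norm_num)
  have h0 : (1 / 2 : ℝ) • (ε / s) • u + (1 / 2 : ℝ) • (ε / s) • (-u) = 0 := by simp
  rw [h0] at hmid
  have h1 := hlin u hu (ε / s) (by positivity)
  have h2 := hlin (-u) (neg_ne_zero.2 hu) (ε / s) (by positivity)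
  simp only [smul_eq_mul] at hmid
  have h3 : ε / s * ρ u + ε / s * ρ (-u) ≤ ε := by
    have : ε / s * s = ε := by field_simp
    have h4 : 0 < ε / s := by positivity
    rw [hs, mul_add, mul_add, mul_one] at this
    linarith
  have := hρ0 0
  linarith

lemma inner_loading [Nontrivial (Cov d)] (hρ0 : ∀ γ, 0 ≤ ρ γ) (hconv : ConvexOn ℝ Set.univ ρ)
    (hgood : ∀ β : Cov d, ∃ b : Cov d, IsGoodSubgradient ρ β b) {β b : Cov d}
    (h : IsSubgradient ρ β b) : inner ℝ β (loading ρ β b) = ρ β := by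
  by_cases hβ : β = 0
  · rw [hβ, inner_zero_left, penalty_zero hρ0 hconv hgood]
  · exact inner_loading_of_ne_zero h hβ

end Penalty

/-! ### Worst-case errors and the meaning of the null hypothesis. -/

section PredictionError

variable {d : ℕ}

@[fun_prop]
lemma continuous_predResid (β : Cov d) : Continuous (predResid β) := by
  unfold predResid
  fun_prop

lemma measurable_predResid (β : Cov d) : Measurable (predResid β) :=
  (continuous_predResid β).measurable

/-- The prediction error as a real number. -/
noncomputable def realError (r : ℝ) (Q : Measure (Obs d)) (β : Cov d) : ℝ :=
  (∫ z, |predResid β z| ^ r ∂Q) ^ (1 / r)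

lemma realError_nonneg (r : ℝ) (Q : Measure (Obs d)) (β : Cov d) : 0 ≤ realError r Q β :=
  Real.rpow_nonneg (integral_nonneg fun _ => Real.rpow_nonneg (abs_nonneg _) _) _

lemma predError_eq_ofReal {r : ℝ} (hr : 1 ≤ r) {Q : Measure (Obs d)} [IsFiniteMeasure Q]
    {β : Cov d} {M : ℝ} (hM : ∀ᵐ z ∂Q, |predResid β z| ≤ M) :
    predError r Q β = ENNReal.ofReal (realError r Q β) := by
  have hint : Integrable (fun z => |predResid β z| ^ r) Q := by
    refine Integrable.of_bound
      (((measurable_predResid β).norm.pow_const r).aestronglyMeasurable) (M ^ r) ?_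
    filter_upwards [hM] with z hz
    rw [Real.norm_of_nonneg (Real.rpow_nonneg (abs_nonneg _) _)]
    exact Real.rpow_le_rpow (abs_nonneg _) hz (by linarith)
  rw [predError, realError, ← ofReal_integral_eq_lintegral_ofReal hint
    (Filter.Eventually.of_forall fun z => Real.rpow_nonneg (abs_nonneg _) _),
    ENNReal.ofReal_rpow_of_nonneg (integral_nonneg fun _ => Real.rpow_nonneg (abs_nonneg _) _)
      (by positivity)]

lemma lintegral_ofReal_abs_rpow_eq {r : ℝ} (hr : 1 ≤ r) {Q : Measure (Obs d)} [IsProbabilityMeasure Q]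
    {f : Obs d → ℝ} {k : ℝ} (hk : 0 ≤ k) (hf : ∀ᵐ z ∂Q, f z = k) :
    (∫⁻ z, ENNReal.ofReal (|f z| ^ r) ∂Q) ^ (1 / r) = ENNReal.ofReal k := by
  have : ∫⁻ z, ENNReal.ofReal (|f z| ^ r) ∂Q = ∫⁻ _z, ENNReal.ofReal (k ^ r) ∂Q := by
    refine lintegral_congr_ae ?_
    filter_upwards [hf] with z hz
    rw [hz, abs_of_nonneg hk]
  rw [this, lintegral_const, measure_univ, mul_one,
    ENNReal.ofReal_rpow_of_nonneg (by positivity) (by positivity), ← Real.rpow_mul hk,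
    mul_one_div_cancel (by positivity), Real.rpow_one]

lemma measurable_shift (r δ : ℝ) (P : Measure (Obs d)) (β : Cov d) :
    Measurable (shift r δ P β) := by
  unfold shift
  split_ifs
  · exact measurable_const
  · exact ((measurable_predResid β).const_mul δ).div_const _

/-- The prediction error under the worst-case distribution. -/
lemma predError_worstCase {r σ δ : ℝ} (hr : 1 ≤ r) (hσ : 0 ≤ σ) (hδ : 0 ≤ δ) {ρ : Cov d → ℝ}
    {P : Measure (Obs d)} [IsProbabilityMeasure P] {β b : Cov d} {M : ℝ}
    (hM : ∀ᵐ z ∂P, |predResid β z| ≤ M) (hρ0 : 0 ≤ ρ β)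
    (hb : inner ℝ β (loading ρ β b) = ρ β) :
    predError r (worstCase r ρ σ δ P β b) β
      = ENNReal.ofReal (realError r P β + δ * (σ + ρ β)) := by
  have hr0 : 0 < r := by linarith
  have hmeas : Measurable fun z : Obs d =>
      (z.1 - shift r δ P β z • loading ρ β b, z.2 + σ * shift r δ P β z) := by
    have := measurable_shift r δ P β
    fun_prop
  have hF : Measurable fun z : Obs d => ENNReal.ofReal (|predResid β z| ^ r) :=
    ((measurable_predResid β).norm.pow_const r).ennreal_ofReal
  have hres : ∀ z : Obs d, predResid β
      (z.1 - shift r δ P β z • loading ρ β b, z.2 + σ * shift r δ P β z)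
        = predResid β z + shift r δ P β z * (σ + ρ β) := by
    intro z
    simp only [predResid]
    rw [inner_sub_left, real_inner_smul_left, real_inner_comm β (loading ρ β b), hb]
    ring
  have hpe := predError_eq_ofReal hr hM
  rw [predError, worstCase, lintegral_map hF hmeas]
  simp_rw [hres]
  -- In the degenerate case the residual vanishes almost surely and the constant shift δ makes it
  -- equal to δ(σ + ρ β).
  by_cases h0 : predError r P β = 0
  · have hre : realError r P β = 0 := by
      rw [hpe, ENNReal.ofReal_eq_zero] at h0
      exact le_antisymm h0 (realError_nonneg _ _ _)
    have hz : ∀ᵐ z ∂P, predResid β z = 0 := by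
      rw [predError, ENNReal.rpow_eq_zero_iff_of_pos (by positivity), lintegral_eq_zero_iff hF] at h0
      filter_upwards [h0] with z hz
      have h1 : |predResid β z| ^ r ≤ 0 := ENNReal.ofReal_eq_zero.1 hz
      have h2 := le_antisymm h1 (Real.rpow_nonneg (abs_nonneg _) _)
      rw [Real.rpow_eq_zero (abs_nonneg _) hr0.ne'] at h2
      exact abs_eq_zero.1 h2
    rw [hre, zero_add]
    refine lintegral_ofReal_abs_rpow_eq hr (by positivity) ?_
    filter_upwards [hz] with z hz
    rw [hz, shift, if_pos h0, zero_add]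
  · have hre : 0 < realError r P β := by
      rw [hpe, ENNReal.ofReal_eq_zero] at h0
      exact not_le.1 h0
    have hk : 0 ≤ 1 + δ * (σ + ρ β) / realError r P β := by positivity
    -- Otherwise the shift is proportional to the residual, which is merely rescaled; the factor
    -- adds exactly δ(σ + ρ β) to its L^r norm.
    have hprod : ∀ z, ENNReal.ofReal (|predResid β z + shift r δ P β z * (σ + ρ β)| ^ r)
        = ENNReal.ofReal (|predResid β z| ^ r)
          * ENNReal.ofReal ((1 + δ * (σ + ρ β) / realError r P β) ^ r) := by
      intro z
      rw [← ENNReal.ofReal_mul (by positivity), ← Real.mul_rpow (abs_nonneg _) hk,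
        shift, if_neg h0, hpe, ENNReal.toReal_ofReal hre.le]
      congr 2
      rw [show predResid β z + δ * predResid β z / realError r P β * (σ + ρ β)
        = predResid β z * (1 + δ * (σ + ρ β) / realError r P β) by ring, abs_mul,
        abs_of_nonneg hk]
    simp_rw [hprod]
    rw [lintegral_mul_const _ hF, ENNReal.mul_rpow_of_nonneg _ _ (by positivity),
      ENNReal.ofReal_rpow_of_nonneg (by positivity) (by positivity), ← Real.rpow_mul hk,
      mul_one_div_cancel hr0.ne', Real.rpow_one, ← predError, hpe,
      ← ENNReal.ofReal_mul hre.le]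
    congr 1
    field_simp

lemma iSup_predError_of_supAchieved {r σ δ : ℝ} {ρ : Cov d → ℝ} {P : Measure (Obs d)}
    {B : Set (Measure (Obs d))} {β b : Cov d} (hmem : worstCase r ρ σ δ P β b ∈ B)
    (hmax : ∀ Q ∈ B, predError r Q β ≤ predError r (worstCase r ρ σ δ P β b) β) :
    ⨆ Q ∈ B, predError r Q β = predError r (worstCase r ρ σ δ P β b) β :=
  le_antisymm (iSup₂_le hmax) (le_iSup₂_of_le _ hmem le_rfl)

/-- The null hypothesis compares the regularized errors under the true distribution. -/
lemma realError_add_le_of_nullHypothesis [Nontrivial (Cov d)] {r σ δ : ℝ} (hr : 1 ≤ r)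
    (hσ : 0 ≤ σ) (hδ : 0 ≤ δ)
    {ρ : Cov d → ℝ} (hρ0 : ∀ γ, 0 ≤ ρ γ) (hconv : ConvexOn ℝ Set.univ ρ)
    (hgood : ∀ β : Cov d, ∃ b : Cov d, IsGoodSubgradient ρ β b)
    {P : Measure (Obs d)} [IsProbabilityMeasure P]
    (hP : ∀ β, ∃ M, ∀ᵐ z ∂P, |predResid β z| ≤ M)
    {B : Set (Measure (Obs d))} {β₁ β₂ : Cov d} (h₁ : SupAchieved r ρ σ δ P B β₁)
    (h₂ : SupAchieved r ρ σ δ P B β₂) (hnull : NullHypothesis r B β₁ β₂) :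
    realError r P β₁ + δ * ρ β₁ ≤ realError r P β₂ + δ * ρ β₂ := by
  obtain ⟨b₁, hb₁, hm₁, hs₁⟩ := h₁
  obtain ⟨b₂, hb₂, hm₂, hs₂⟩ := h₂
  obtain ⟨M₁, hM₁⟩ := hP β₁
  obtain ⟨M₂, hM₂⟩ := hP β₂
  rw [NullHypothesis, iSup_predError_of_supAchieved hm₁ hs₁, iSup_predError_of_supAchieved hm₂ hs₂,
    predError_worstCase hr hσ hδ hM₁ (hρ0 _) (inner_loading hρ0 hconv hgood hb₁.1),
    predError_worstCase hr hσ hδ hM₂ (hρ0 _) (inner_loading hρ0 hconv hgood hb₂.1),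
    ENNReal.ofReal_le_ofReal_iff] at hnull
  · linarith
  · have := realError_nonneg r P β₂
    have := hρ0 β₂
    positivity

end PredictionError

/-! ### Dual norm and oscillation of residuals over the support. -/

section DualNorm

variable {d : ℕ} (N : Seminorm ℝ (Obs d))

/-- A definite seminorm has a positive minimum on the compact unit sphere. This bounds the sets in
`dualNorm` and `suppDiam`, whose `sSup` would otherwise default to 0. -/
lemma exists_norm_le_seminorm (hN : ∀ z : Obs d, N z = 0 → z = 0) :
    ∃ C : ℝ, 0 ≤ C ∧ ∀ z : Obs d, ‖z‖ ≤ C * N z := by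
  have hcont : Continuous N :=
    continuousOn_univ.1 (N.convexOn.continuousOn isOpen_univ)
  obtain ⟨w, hw, hmin⟩ := (isCompact_sphere (0 : Obs d) 1).exists_isMinOn
    (NormedSpace.sphere_nonempty.2 zero_le_one) hcont.continuousOn
  have hw1 : ‖w‖ = 1 := by simpa using hw
  have hpos : 0 < N w := (apply_nonneg N w).lt_of_ne' fun h => by
    rw [hN w h, norm_zero] at hw1
    exact zero_ne_one hw1
  refine ⟨(N w)⁻¹, by positivity, fun z => ?_⟩
  rcases eq_or_ne z 0 with rfl | hz
  · simp
  have hz0 : 0 < ‖z‖ := norm_pos_iff.2 hz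
  have h : N w ≤ N (‖z‖⁻¹ • z) := hmin (by simp [norm_smul, hz0.ne'])
  rw [map_smul_eq_mul, norm_inv, norm_norm, inv_mul_eq_div, le_div_iff₀ hz0] at h
  rw [inv_mul_eq_div, le_div_iff₀ hpos]
  linarith

/-- The standard inner product on `ℝ^(d+1)`. -/
noncomputable def obsPairing (x z : Obs d) : ℝ := inner ℝ x.1 z.1 + x.2 * z.2

lemma obsPairing_smul_left (a : ℝ) (x z : Obs d) :
    obsPairing (a • x) z = a * obsPairing x z := by
  simp only [obsPairing, Prod.smul_fst, Prod.smul_snd, real_inner_smul_left, smul_eq_mul]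
  ring

/-- The norm of the product type is the maximum norm, hence the factor 2. -/
lemma abs_obsPairing_le (x z : Obs d) : |obsPairing x z| ≤ 2 * ‖x‖ * ‖z‖ := by
  have h1 : |inner ℝ x.1 z.1| ≤ ‖x‖ * ‖z‖ := (abs_real_inner_le_norm _ _).trans
    (mul_le_mul (norm_fst_le x) (norm_fst_le z) (norm_nonneg _) (norm_nonneg _))
  have h2 : |x.2 * z.2| ≤ ‖x‖ * ‖z‖ := by
    rw [abs_mul]
    exact mul_le_mul (norm_snd_le x) (norm_snd_le z) (abs_nonneg _) (norm_nonneg _)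
  have := abs_add_le (inner ℝ x.1 z.1) (x.2 * z.2)
  rw [obsPairing]
  linarith

variable {N}

lemma obsPairing_le_of_seminorm_eq_one {C : ℝ} (hC : ∀ z : Obs d, ‖z‖ ≤ C * N z) {x : Obs d}
    (hx : N x = 1) (z : Obs d) : obsPairing x z ≤ 2 * C * ‖z‖ := by
  have h := hC x
  rw [hx, mul_one] at h
  refine (le_abs_self _).trans ((abs_obsPairing_le x z).trans ?_)
  gcongr

lemma dualNorm_le {C : ℝ} (hC0 : 0 ≤ C) (hC : ∀ z : Obs d, ‖z‖ ≤ C * N z) (z : Obs d) :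
    dualNorm N z ≤ 2 * C * ‖z‖ := by
  refine Real.sSup_le ?_ (by positivity)
  rintro _ ⟨x, hx, rfl⟩
  exact obsPairing_le_of_seminorm_eq_one hC hx z

lemma obsPairing_le_dualNorm (hN : ∀ z : Obs d, N z = 0 → z = 0) {x : Obs d} (hx : N x = 1)
    (z : Obs d) : obsPairing x z ≤ dualNorm N z := by
  obtain ⟨C, -, hC⟩ := exists_norm_le_seminorm N hN
  refine le_csSup ⟨2 * C * ‖z‖, ?_⟩ ⟨x, hx, rfl⟩
  rintro _ ⟨y, hy, rfl⟩
  exact obsPairing_le_of_seminorm_eq_one hC hy z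

/-- Hölder's inequality for a norm and its dual norm. -/
lemma abs_obsPairing_le_mul_dualNorm (hN : ∀ z : Obs d, N z = 0 → z = 0) (x z : Obs d) :
    |obsPairing x z| ≤ N x * dualNorm N z := by
  rcases (apply_nonneg N x).eq_or_lt with h | h
  · rw [hN x h.symm]
    simp [obsPairing]
  have key : ∀ a : ℝ, |a| = (N x)⁻¹ → a * obsPairing x z ≤ dualNorm N z := by
    intro a ha
    rw [← obsPairing_smul_left]
    refine obsPairing_le_dualNorm hN ?_ z
    rw [map_smul_eq_mul, Real.norm_eq_abs, ha, inv_mul_cancel₀ h.ne']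
  have h1 := key (N x)⁻¹ (abs_of_pos (by positivity))
  have h2 := key (-(N x)⁻¹) (by rw [abs_neg, abs_of_pos (by positivity)])
  rw [neg_mul, inv_mul_eq_div] at h2
  rw [inv_mul_eq_div, div_le_iff₀ h] at h1
  rw [neg_le, le_div_iff₀ h] at h2
  rw [abs_le]
  constructor <;> linarith

lemma dualNorm_nonneg (hN : ∀ z : Obs d, N z = 0 → z = 0) (z : Obs d) : 0 ≤ dualNorm N z := by
  have hpos : 0 < N ((0, 1) : Obs d) := (apply_nonneg N _).lt_of_ne' fun h => by
    have := congrArg Prod.snd (hN _ h)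
    simp at this
  have h := (abs_nonneg _).trans (abs_obsPairing_le_mul_dualNorm hN ((0, 1) : Obs d) z)
  exact nonneg_of_mul_nonneg_right h hpos

lemma suppDiam_nonneg (hN : ∀ z : Obs d, N z = 0 → z = 0) (P : Measure (Obs d)) :
    0 ≤ suppDiam N P :=
  Real.sSup_nonneg (by rintro _ ⟨z, -, z', -, rfl⟩; exact dualNorm_nonneg hN _)

lemma dualNorm_sub_le_suppDiam (hN : ∀ z : Obs d, N z = 0 → z = 0) {P : Measure (Obs d)}
    (hP : IsCompact P.support) {z z' : Obs d} (hz : z ∈ P.support) (hz' : z' ∈ P.support) :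
    dualNorm N (z - z') ≤ suppDiam N P := by
  obtain ⟨C, hC0, hC⟩ := exists_norm_le_seminorm N hN
  obtain ⟨R, hR⟩ := hP.isBounded.exists_norm_le
  refine le_csSup ⟨2 * C * (R + R), ?_⟩ ⟨z, hz, z', hz', rfl⟩
  rintro _ ⟨w, hw, w', hw', rfl⟩
  refine (dualNorm_le hC0 hC _).trans ?_
  gcongr
  exact (norm_sub_le _ _).trans (add_le_add (hR w hw) (hR w' hw'))

/-- The residuals vary by at most `N (γ, -1) * diam (supp P)` over the support. -/
lemma abs_predResid_sub_le (hN : ∀ z : Obs d, N z = 0 → z = 0) {P : Measure (Obs d)}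
    (hP : IsCompact P.support) (γ : Cov d) {z z' : Obs d} (hz : z ∈ P.support)
    (hz' : z' ∈ P.support) :
    |predResid γ z - predResid γ z'| ≤ N (γ, -1) * suppDiam N P := by
  have h : predResid γ z - predResid γ z' = - obsPairing (γ, -1) (z - z') := by
    simp only [predResid, obsPairing, Prod.fst_sub, Prod.snd_sub, inner_sub_right,
      real_inner_comm γ]
    ring
  rw [h, abs_neg]
  refine (abs_obsPairing_le_mul_dualNorm hN _ _).trans ?_
  gcongr
  exact dualNorm_sub_le_suppDiam hN hP hz hz'

end DualNorm

/-! ### Empirical measure as normalized counts. -/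

section EmpiricalMeasure

variable {d n : ℕ}

lemma empirical_apply (z : Fin n → Obs d) {A : Set (Obs d)} (hA : MeasurableSet A) :
    empirical z A = ENNReal.ofReal (hits A z / n) := by
  rcases n.eq_zero_or_pos with rfl | hn
  · simp [empirical, hits]
  have hn' : (0 : ℝ) < n := by exact_mod_cast hn
  have hsum : ∑ i, Measure.dirac (z i) A = ENNReal.ofReal (hits A z) := by
    rw [hits, ENNReal.ofReal_sum_of_nonneg fun i _ => indicator_one_nonneg _ _]
    refine Finset.sum_congr rfl fun i _ => ?_
    rw [Measure.dirac_apply' _ hA]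
    by_cases h : z i ∈ A <;> simp [h]
  rw [empirical, Measure.smul_apply, Measure.finsetSum_apply, hsum, smul_eq_mul,
    ENNReal.ofReal_div_of_pos hn', ENNReal.ofReal_natCast, ENNReal.div_eq_inv_mul]

lemma empirical_real_apply (z : Fin n → Obs d) {A : Set (Obs d)} (hA : MeasurableSet A) :
    (empirical z).real A = hits A z / n := by
  rw [measureReal_def, empirical_apply z hA,
    ENNReal.toReal_ofReal (div_nonneg (hits_nonneg _ _) n.cast_nonneg)]

lemma isProbabilityMeasure_empirical (hn : 0 < n) (z : Fin n → Obs d) :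
    IsProbabilityMeasure (empirical z) := by
  refine ⟨?_⟩
  have hn' : (n : ℝ) ≠ 0 := by positivity
  rw [empirical_apply z MeasurableSet.univ]
  simp [hits, hn']

lemma ae_empirical {z : Fin n → Obs d} {K : Set (Obs d)} (hK : MeasurableSet K)
    (hz : ∀ i, z i ∈ K) : ∀ᵐ w ∂(empirical z), w ∈ K := by
  change empirical z Kᶜ = 0
  rw [empirical_apply z hK.compl, ENNReal.ofReal_eq_zero]
  simp [hits, hz]

end EmpiricalMeasure

/-! ### Bounding the test statistic by the half-space deviation. -/

section TestStatistic

variable {d n : ℕ}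

/-- The maximal deviation of a sample over a countable dense family of half-spaces. -/
noncomputable def halfspaceDeviation (P : Measure (Obs d)) (z : Fin n → Obs d) : ℝ :=
  maxDeviation (fun j : ℕ => openHalfspace (TopologicalSpace.denseSeq (Cov d × ℝ × ℝ) j)) P z

/-- With m the minimum of |residual| on the support, an interval of length L suffices, so the moment
comparison sees the oscillation of the residual and not its size. -/
lemma exists_predResid_range {P : Measure (Obs d)} [IsProbabilityMeasure P]
    (hP : IsCompact P.support) (γ : Cov d) {L : ℝ}
    (hL : ∀ z ∈ P.support, ∀ z' ∈ P.support, |predResid γ z - predResid γ z'| ≤ L) :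
    ∃ m, 0 ≤ m ∧ ∀ z ∈ P.support, m ≤ |predResid γ z| ∧ |predResid γ z| ≤ m + L := by
  obtain ⟨w, hw, hmin⟩ := hP.exists_isMinOn
    (Measure.nonempty_support (IsProbabilityMeasure.ne_zero P))
    (continuous_predResid γ).abs.continuousOn
  refine ⟨|predResid γ w|, abs_nonneg _, fun z hz => ⟨hmin hz, ?_⟩⟩
  have h1 := hL z hz w hw
  have h2 := abs_sub_abs_le_abs_sub (predResid γ z) (predResid γ w)
  linarith

lemma exists_ae_abs_predResid_le {P : Measure (Obs d)} [IsProbabilityMeasure P]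
    (hP : IsCompact P.support) (γ : Cov d) : ∃ M, ∀ᵐ z ∂P, |predResid γ z| ≤ M := by
  obtain ⟨M, hM⟩ := hP.exists_bound_of_continuousOn (continuous_predResid γ).continuousOn
  refine ⟨M, ?_⟩
  filter_upwards [Measure.support_mem_ae (μ := P)] with z hz using hM z hz

/-- The distribution functions of the residuals are controlled by the half-space deviation. -/
lemma abs_empirical_sub_le (hn : 0 < n) {P : Measure (Obs d)} [IsProbabilityMeasure P]
    (hP : IsCompact P.support) {z : Fin n → Obs d} (hz : ∀ i, z i ∈ P.support)
    (p : Cov d × ℝ × ℝ) :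
    |(empirical z).real (openHalfspace p) - P.real (openHalfspace p)|
      ≤ halfspaceDeviation P z / n := by
  obtain ⟨R, hR⟩ := hP.isBounded.exists_norm_le
  have hR0 : 0 ≤ R := (norm_nonneg _).trans (hR _ (hz ⟨0, hn⟩))
  have hn' : (0 : ℝ) < n := by exact_mod_cast hn
  have hPR : ∀ᵐ z ∂P, ‖z‖ ≤ R := by
    filter_upwards [Measure.support_mem_ae (μ := P)] with z hz using hR z hz
  have h := abs_hits_openHalfspace_sub_le P hR0 hPR (fun i => hR _ (hz i)) p
  rw [empirical_real_apply z (measurableSet_openHalfspace p), le_div_iff₀ hn']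
  calc |hits (openHalfspace p) z / n - P.real (openHalfspace p)| * n
      = |(hits (openHalfspace p) z / n - P.real (openHalfspace p)) * n| := by
        rw [abs_mul, abs_of_pos hn']
    _ = |hits (openHalfspace p) z - n * P.real (openHalfspace p)| := by
        congr 1; field_simp
    _ ≤ _ := h

/-- The empirical prediction error is uniformly close to the true one, relative to the penalty. -/
lemma abs_realError_empirical_sub_le {r L : ℝ} (hr : 1 ≤ r) (hL0 : 0 ≤ L) (hn : 0 < n)
    {P : Measure (Obs d)} [IsProbabilityMeasure P] (hP : IsCompact P.support)
    {z : Fin n → Obs d} (hz : ∀ i, z i ∈ P.support) (γ : Cov d)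
    (hL : ∀ z ∈ P.support, ∀ z' ∈ P.support, |predResid γ z - predResid γ z'| ≤ L) :
    |realError r (empirical z) γ - realError r P γ|
      ≤ L * (2 * (halfspaceDeviation P z / n)) ^ (1 / r) := by
  have := isProbabilityMeasure_empirical hn z
  obtain ⟨m, hm0, hm⟩ := exists_predResid_range hP γ hL
  have hε : 0 ≤ halfspaceDeviation P z / n :=
    div_nonneg (maxDeviation_nonneg _ _ _) n.cast_nonneg
  have hPm : ∀ᵐ w ∂P, m ≤ |predResid γ w| ∧ |predResid γ w| ≤ m + L := by
    filter_upwards [Measure.support_mem_ae (μ := P)] with w hw using hm w hw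
  have hem : ∀ᵐ w ∂(empirical z), m ≤ |predResid γ w| ∧ |predResid γ w| ≤ m + L := by
    filter_upwards [ae_empirical hP.measurableSet hz] with w hw using hm w hw
  -- The tail events of all residuals are half-spaces, which makes one deviation serve every γ.
  have hset1 : ∀ t, {w | t < predResid γ w} = openHalfspace (-γ, 1, t) := by
    intro t
    ext w
    rw [mem_openHalfspace, Set.mem_ofPred_eq, predResid, inner_neg_right]
    ring_nf
  have hset2 : ∀ t, {w | t < - predResid γ w} = openHalfspace (γ, -1, t) := by
    intro t
    ext w
    rw [mem_openHalfspace, Set.mem_ofPred_eq, predResid]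
    ring_nf
  have h1 : ∀ t, |(empirical z).real {w | t < predResid γ w} - P.real {w | t < predResid γ w}|
      ≤ halfspaceDeviation P z / n := fun t => by
    rw [hset1]; exact abs_empirical_sub_le hn hP hz _
  have h2 : ∀ t, |(empirical z).real {w | t < - predResid γ w}
      - P.real {w | t < - predResid γ w}| ≤ halfspaceDeviation P z / n := fun t => by
    rw [hset2]; exact abs_empirical_sub_le hn hP hz _
  have k1 := abs_moment_le_add_of_discrepancy (measurable_predResid γ) hm0 hL0 hε hr hem hPm h1 h2
  have k2 := abs_moment_le_add_of_discrepancy (measurable_predResid γ) hm0 hL0 hε hr hPm hem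
    (fun t => by rw [abs_sub_comm]; exact h1 t) (fun t => by rw [abs_sub_comm]; exact h2 t)
  rw [abs_le]
  unfold realError
  constructor <;> linarith

lemma predError_empirical_toReal {r : ℝ} (hr : 1 ≤ r) (hn : 0 < n) {P : Measure (Obs d)}
    (hP : IsCompact P.support) {z : Fin n → Obs d} (hz : ∀ i, z i ∈ P.support) (γ : Cov d) :
    (predError r (empirical z) γ).toReal = realError r (empirical z) γ := by
  have := isProbabilityMeasure_empirical hn z
  obtain ⟨M, hM⟩ := hP.exists_bound_of_continuousOn (continuous_predResid γ).continuousOn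
  rw [predError_eq_ofReal hr (M := M), ENNReal.toReal_ofReal (realError_nonneg _ _ _)]
  filter_upwards [ae_empirical hP.measurableSet hz] with w hw using hM w hw

/-- Under the null hypothesis the test statistic is controlled by the half-space deviation. -/
lemma testStat_le {r σ δ : ℝ} (hr : 1 ≤ r) (hσ : 1 ≤ σ) {ρ : Cov d → ℝ}
    (hρ_nonneg : ∀ γ, 0 ≤ ρ γ)
    {N : Seminorm ℝ (Obs d)} (hN : ∀ z : Obs d, N z = 0 → z = 0) {c : ℝ} (hc_pos : 0 < c)
    (hc : ∀ γ : Cov d, c * N (γ, -1) ≤ ρ γ + 1)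
    {P : Measure (Obs d)} [IsProbabilityMeasure P] (hP : IsCompact P.support) (hn : 0 < n)
    {z : Fin n → Obs d} (hz : ∀ i, z i ∈ P.support) {β₁ β₂ : Cov d}
    (hnull : realError r P β₁ + δ * ρ β₁ ≤ realError r P β₂ + δ * ρ β₂) :
    testStat r ρ σ δ z β₁ β₂ ≤ max (1 / c) 1 * suppDiam N P
      * (2 * halfspaceDeviation P z / √n) ^ (1 / r) := by
  have hr0 : 0 < r := by linarith
  have hn' : (0 : ℝ) < n := by exact_mod_cast hn
  set W := halfspaceDeviation P z with hW
  have hW0 : 0 ≤ W := maxDeviation_nonneg _ _ _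
  set K := max (1 / c) 1 * suppDiam N P with hK
  have hD0 := suppDiam_nonneg hN P
  have hK0 : 0 ≤ K := by positivity
  -- Since σ ≥ 1, N(γ, -1) ≤ (ρ γ + 1)/c is at most (σ + ρ γ) max(1/c, 1). The weights for β₁ and β₂
  -- add up to the denominator of T_n and cancel.
  have herr : ∀ γ, |realError r (empirical z) γ - realError r P γ|
      ≤ ((σ + ρ γ) * K) * (2 * (W / n)) ^ (1 / r) := by
    intro γ
    have := hρ_nonneg γ
    refine abs_realError_empirical_sub_le hr (by positivity) hn hP hz γ fun w hw w' hw' => ?_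
    refine (abs_predResid_sub_le hN hP γ hw hw').trans ?_
    rw [hK, ← mul_assoc]
    gcongr
    calc N (γ, -1) ≤ (ρ γ + 1) / c := by
          rw [le_div_iff₀ hc_pos]; linarith [hc γ]
      _ = (ρ γ + 1) * (1 / c) := by ring
      _ ≤ (σ + ρ γ) * max (1 / c) 1 :=
          mul_le_mul (by linarith) (le_max_left _ _) (by positivity) (by linarith)
  have e1 := (abs_le.1 (herr β₁)).2
  have e2 := (abs_le.1 (herr β₂)).1
  have hden : 0 < 2 * σ + ρ β₁ + ρ β₂ := by linarith [hρ_nonneg β₁, hρ_nonneg β₂]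
  have hsqrt : (n : ℝ) ^ (1 / (2 * r)) * (2 * (W / n)) ^ (1 / r) = (2 * W / √n) ^ (1 / r) := by
    rw [show 1 / (2 * r) = 1 / 2 * (1 / r) by field_simp, Real.rpow_mul hn'.le,
      ← Real.sqrt_eq_rpow, ← Real.mul_rpow (by positivity) (by positivity)]
    congr 1
    have hs : √(n : ℝ) * √n = n := Real.mul_self_sqrt hn'.le
    rw [eq_div_iff (Real.sqrt_ne_zero'.2 hn')]
    calc √(n : ℝ) * (2 * (W / n)) * √n = 2 * W * (√(n : ℝ) * √n / n) := by ring
      _ = 2 * W := by rw [hs, div_self hn'.ne', mul_one]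
  rw [testStat, predError_empirical_toReal hr hn hP hz, predError_empirical_toReal hr hn hP hz]
  calc _ ≤ (n : ℝ) ^ (1 / (2 * r)) * (K * (2 * (W / n)) ^ (1 / r)) := by
        gcongr
        rw [div_le_iff₀ hden]
        linarith
    _ = K * ((n : ℝ) ^ (1 / (2 * r)) * (2 * (W / n)) ^ (1 / r)) := by ring
    _ = _ := by rw [hsqrt]

/-- Serves the case d = 0, where the predictors coincide and ρ(0) = 0 is not forced. -/
lemma testStat_self (r σ δ : ℝ) (ρ : Cov d → ℝ) (z : Fin n → Obs d) (β : Cov d) :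
    testStat r ρ σ δ z β β = 0 := by
  simp [testStat]

/-- The concentration of the half-space deviation at the level `α`. -/
lemma measure_halfspaceDeviation_ge_le {P : Measure (Obs d)} [IsProbabilityMeasure P] (hn : 0 < n)
    {α : ℝ} (hα_pos : 0 < α) (hα_lt : α < 1) :
    (Measure.pi fun _ : Fin n => P)
      {z | 32 * √(n * (d + 2 : ℕ)) + √n * √(2 * Real.log (1 / α)) / 2 ≤ halfspaceDeviation P z}
        ≤ ENNReal.ofReal α := by
  have hn' : (0 : ℝ) < n := by exact_mod_cast hn
  have hlog : 0 ≤ Real.log (1 / α) :=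
    Real.log_nonneg (by rw [le_div_iff₀ hα_pos]; linarith)
  have h := measureReal_pi_maxDeviation_ge_le (n := n)
    (fun j : ℕ => measurableSet_openHalfspace (TopologicalSpace.denseSeq (Cov d × ℝ × ℝ) j))
    (show 1 ≤ d + 2 by omega) (shatterBound_openHalfspace _) P hn
    (t := √n * √(2 * Real.log (1 / α)) / 2) (by positivity)
  -- The deviation t was chosen so that 2t²/n = log(1/α).
  rw [show Real.exp (-(2 * (√n * √(2 * Real.log (1 / α)) / 2) ^ 2 / n)) = α by
    rw [div_pow, mul_pow, Real.sq_sqrt hn'.le, Real.sq_sqrt (by positivity),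
      show -(2 * (n * (2 * Real.log (1 / α)) / 2 ^ 2) / n) = - Real.log (1 / α) by
        field_simp, one_div, Real.log_inv, neg_neg, Real.exp_log hα_pos]] at h
  rw [← ENNReal.ofReal_toReal (measure_ne_top (Measure.pi fun _ : Fin n => P) _)]
  exact ENNReal.ofReal_le_ofReal h

end TestStatistic

/-! ### The level of the test. -/

theorem corollary2 {d : ℕ} (r σ : ℝ) (hr : 1 ≤ r) (hσ : 1 ≤ σ)
    -- the penalty
    (ρ : Cov d → ℝ) (hρ_nonneg : ∀ γ, 0 ≤ ρ γ) (hρ_convex : ConvexOn ℝ Set.univ ρ)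
    (hρ : ∀ β : Cov d, ∃ b : Cov d, IsGoodSubgradient ρ β b)
    -- the norm on `ℝ^(d+1)` and the constant `c_d`
    (N : Seminorm ℝ (Obs d)) (hN : ∀ z : Obs d, N z = 0 → z = 0)
    (c_d : ℝ) (hc_pos : 0 < c_d) (hc : ∀ γ : Cov d, c_d * N (γ, -1) ≤ ρ γ + 1)
    -- the true distribution, with compact support
    (P : Measure (Obs d)) [IsProbabilityMeasure P] (hP : IsCompact P.support)
    -- the sample of `n` independent draws from `P`
    {Ω : Type*} [MeasurableSpace Ω] (μ : Measure Ω) [IsProbabilityMeasure μ]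
    (n : ℕ) (hn : 0 < n) (Z : Fin n → Ω → Obs d) (hZ_meas : ∀ i, Measurable (Z i))
    (hZ_indep : iIndepFun Z μ) (hZ_law : ∀ i, μ.map (Z i) = P)
    -- the level and the uncertainty set
    (α : ℝ) (hα_pos : 0 < α) (hα_lt : α < 1)
    (δ : ℝ) (hδ : 0 ≤ δ) (B : Set (Measure (Obs d))) (hB : B ⊆ mswBall r ρ σ δ P)
    -- the two estimators (possibly data-dependent), satisfying the null hypothesis
    (β₁ β₂ : Ω → Cov d)
    (h₁ : ∀ᵐ ω ∂μ, SupAchieved r ρ σ δ P B (β₁ ω))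
    (h₂ : ∀ᵐ ω ∂μ, SupAchieved r ρ σ δ P B (β₂ ω))
    (hnull : ∀ᵐ ω ∂μ, NullHypothesis r B (β₁ ω) (β₂ ω)) :
    μ {ω | max (1 / c_d) 1 * constC r α N P ^ (1 / r)
        < testStat r ρ σ δ (fun i => Z i ω) (β₁ ω) (β₂ ω)} ≤ ENNReal.ofReal α := by
  have hr0 : 0 < r := by linarith
  have hn' : (0 : ℝ) < n := by exact_mod_cast hn
  have hD0 := suppDiam_nonneg hN P
  have hlaw : μ.map (fun ω i => Z i ω) = Measure.pi fun _ : Fin n => P := by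
    rw [(iIndepFun_iff_map_fun_eq_pi_map fun i => (hZ_meas i).aemeasurable).1 hZ_indep]
    simp_rw [hZ_law]
  have hZm : Measurable fun ω i => Z i ω := measurable_pi_lambda _ hZ_meas
  have hsupp : ∀ᵐ ω ∂μ, ∀ i, Z i ω ∈ P.support := by
    rw [ae_all_iff]
    intro i
    have h := Measure.support_mem_ae (μ := P)
    rw [← hZ_law i] at h
    have h' := ae_of_ae_map (hZ_meas i).aemeasurable h
    rwa [hZ_law i] at h'
  have herr : ∀ᵐ ω ∂μ, β₁ ω = β₂ ω ∨ realError r P (β₁ ω) + δ * ρ (β₁ ω)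
      ≤ realError r P (β₂ ω) + δ * ρ (β₂ ω) := by
    rcases subsingleton_or_nontrivial (Cov d) with hd | hd
    · exact Filter.Eventually.of_forall fun ω => Or.inl (Subsingleton.elim _ _)
    · filter_upwards [h₁, h₂, hnull] with ω k₁ k₂ k
      exact Or.inr (realError_add_le_of_nullHypothesis hr (by linarith) hδ hρ_nonneg hρ_convex hρ
        (fun β => exists_ae_abs_predResid_le hP β) k₁ k₂ k)
  -- An event of the sample alone, hence measurable; the rejection event need not be, as the
  -- predictors are arbitrary functions, and is only compared in outer measure.
  set A : Set (Fin n → Obs d) := {z | 32 * √(n * (d + 2 : ℕ))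
    + √n * √(2 * Real.log (1 / α)) / 2 ≤ halfspaceDeviation P z} with hA
  have hAm : MeasurableSet A := measurableSet_le measurable_const
    (measurable_maxDeviation (fun j => measurableSet_openHalfspace _) P)
  calc μ {ω | max (1 / c_d) 1 * constC r α N P ^ (1 / r)
        < testStat r ρ σ δ (fun i => Z i ω) (β₁ ω) (β₂ ω)}
      ≤ μ ((fun ω i => Z i ω) ⁻¹' A) := by
        refine measure_mono_ae ?_
        filter_upwards [hsupp, herr] with ω hω hβ hT
        change max (1 / c_d) 1 * constC r α N P ^ (1 / r)
          < testStat r ρ σ δ (fun i => Z i ω) (β₁ ω) (β₂ ω) at hT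
        by_contra hlt
        have hlt' : halfspaceDeviation P (fun i => Z i ω) < 32 * √(n * (d + 2 : ℕ))
            + √n * √(2 * Real.log (1 / α)) / 2 := not_le.1 hlt
        refine absurd hT (not_lt.2 ?_)
        have hW0 : 0 ≤ halfspaceDeviation P (fun i => Z i ω) := maxDeviation_nonneg _ _ _
        set k := 180 * √((d : ℝ) + 2) + √(2 * Real.log (1 / α)) with hk
        have hk0 : 0 ≤ k := by positivity
        have hC : max (1 / c_d) 1 * constC r α N P ^ (1 / r)
            = max (1 / c_d) 1 * suppDiam N P * k ^ (1 / r) := by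
          rw [constC, ← hk, Real.mul_rpow hk0 (by positivity), ← Real.rpow_mul hD0,
            mul_one_div_cancel hr0.ne', Real.rpow_one]
          ring
        rw [hC]
        rcases hβ with hβ | hβ
        · rw [hβ, testStat_self]
          positivity
        · refine (testStat_le hr hσ hρ_nonneg hN hc_pos hc hP hn hω hβ).trans ?_
          gcongr
          rw [div_le_iff₀ (by positivity)]
          rw [Real.sqrt_mul hn'.le] at hlt'
          push_cast at hlt'
          -- Doubling the deviation bound yields 64√(d+2), below the allowed 180√(d+2), and exactly
          -- √(2 log(1/α)).
          have : 0 ≤ √(n : ℝ) * √((d : ℝ) + 2) := by positivity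
          rw [hk]
          linarith
    _ = Measure.pi (fun _ : Fin n => P) A := by rw [← hlaw, Measure.map_apply hZm hAm]
    _ ≤ ENNReal.ofReal α := measure_halfspaceDeviation_ge_le hn hα_pos hα_lt
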